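/- Let $d\in\mathbb N$ and equip $\mathbb R^d$ with the Euclidean norm and inner product. Let $\mathtt m\in\mathbb R$, $\mathtt m^+>0$, $L\ge 0$, $R>0$, and let $b:\mathbb R^d\to\mathbb R^d$ satisfy, for all $x,y\in\mathbb R^d$, $$\|b(x)-b(y)\|\le L\|x-y\|,\qquad \langle b(x)-b(y),x-y\rangle\le-\mathtt m\|x-y\|^2,$$ and $\langle b(x)-b(y),x-y\rangle\le-\mathtt m^+\|x-y\|^2$ whenever $\|x-y\|\ge R$. For $\gamma>0$ let $\mathrm R_\gamma$ be the Markov kernel of the Euler–Maruyama chain $X_{k+1}=X_k+\gamma b(X_k)+\sqrt\gamma Z_{k+1}$, with $(Z_k)_{k\ge1}$ i.i.d. standard Gaussian on $\mathbb R^d$, so that $\delta_x\mathrm R_\gamma^k$ is the law of $X_k$ started at $x$. For probability measures $\mu,\nu$ put $\mathbf W_{\mathbf c}(\mu,\nu)=\inf_\zeta\int\mathbf c\,d\zeta$, the infimum being over all couplings $\zeta$ of $\mu$ and $\nu$, where $\mathbf c(x,y)=\mathbb 1_{x\ne y}(1+\|x-y\|/R)$. Let $\bar\gamma>0$ be any number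 with $\bar\gamma L^2<2\mathtt m^+$ and let $\ell\ge1$ be any integer. Put $\mathtt m_0=\min(\mathtt m,0)$ and let $\Phi$ be the standard normal distribution function. Define $$\lambda_{\bar\gamma}=\exp\!\big[-\tfrac12(\mathtt m^+-\bar\gamma L^2/2)\big],\quad A=\mathtt m^+-\mathtt m_0,\quad \kappa(\gamma)=-2\mathtt m_0+\gamma L^2,\quad \Xi_n(\gamma)=\gamma\sum_{j=1}^n(1+\gamma\kappa(\gamma))^{-j},$$ $$\varepsilon=\inf_{0<\gamma\le\bar\gamma}2\Phi\Big(-\frac{R}{2\,\Xi_{\ell\lceil1/\gamma\rceil}(\gamma)^{1/2}}\Big),\qquad S=A\,\lambda_{\bar\gamma}^{-(1+\bar\gamma)\ell}(1+\bar\gamma)\ell,\qquad \log\rho_{\bar\gamma}=\frac{\log\lambda_{\bar\gamma}\,\log(1-\varepsilon)}{-\log(2+S)+\log(1-\varepsilon)},$$ $$D_{\bar\gamma,1}=1+\frac{4A}{\log(1/\lambda_{\bar\gamma})\,\lambda_{\bar\gamma}^{\bar\gamma}},\qquad D_{\bar\gamma,2}=D_{\bar\gamma,1}S,\qquad E_{\bar\gamma}=\frac{8A}{\log(1/\rho_{\bar\gamma})\,\rho_{\bar\gamma}^{\bar\gamma}}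 .$$ Then $D_{\bar\gamma,1},D_{\bar\gamma,2},E_{\bar\gamma}\ge0$ and $0\le\lambda_{\bar\gamma}\le\rho_{\bar\gamma}<1$, and for all $\gamma\in(0,\bar\gamma]$, $x,y\in\mathbb R^d$ and $k\in\mathbb N$, $$\mathbf W_{\mathbf c}(\delta_x\mathrm R_\gamma^k,\delta_y\mathrm R_\gamma^k)\le\lambda_{\bar\gamma}^{k\gamma/4}\big[D_{\bar\gamma,1}\,\mathbf c(x,y)+D_{\bar\gamma,2}\,\mathbb 1_{x\ne y}\big]+E_{\bar\gamma}\,\rho_{\bar\gamma}^{k\gamma/4}\,\mathbb 1_{x\ne y}.$$ In particular $\bar\gamma$, both rates and all constants depend only on $\mathtt m,\mathtt m^+,L,R$ (and the choice of $\bar\gamma,\ell$), not on $d$ or $b$. -/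

import Mathlib

open MeasureTheory ProbabilityTheory

namespace EulerMaruyama

noncomputable section

/-! ### The Markov kernel -/

/-- The Markov kernel `R_γ` of the recursion `X_{k+1} = X_k + γ b(X_k) + √γ Z_{k+1}` with i.i.d.
standard Gaussian `Z_k`: the law of `x + γ b(x) + √γ Z` with `Z ∼ N(0, Id)`, started at `x`.
The drift `b` has to be measurable, see `stepKernel_apply`. The law of `X_k` started at `x` is
`(stepKernel b γ ^ k) x`, where the power is the one for the composition of kernels. -/
def stepKernel {d : ℕ} (b : EuclideanSpace ℝ (Fin d) → EuclideanSpace ℝ (Fin d)) (γ : ℝ) :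
    Kernel (EuclideanSpace ℝ (Fin d)) (EuclideanSpace ℝ (Fin d)) :=
  (Kernel.id ×ₖ Kernel.const (EuclideanSpace ℝ (Fin d))
      (stdGaussian (EuclideanSpace ℝ (Fin d)))).map
    (fun p => p.1 + γ • b p.1 + √γ • p.2)

theorem stepKernel_apply {d : ℕ} {b : EuclideanSpace ℝ (Fin d) → EuclideanSpace ℝ (Fin d)}
    (hb : Measurable b) (γ : ℝ) (x : EuclideanSpace ℝ (Fin d)) :
    stepKernel b γ x =
      (stdGaussian (EuclideanSpace ℝ (Fin d))).map (fun z => x + γ • b x + √γ • z) := by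
  have hf : Measurable (fun p : EuclideanSpace ℝ (Fin d) × EuclideanSpace ℝ (Fin d) =>
      p.1 + γ • b p.1 + √γ • p.2) := by fun_prop
  rw [stepKernel, Kernel.map_apply _ hf, Kernel.prod_apply, Kernel.id_apply, Kernel.const_apply,
    Measure.dirac_prod, Measure.map_map hf (by fun_prop)]
  rfl

/-! ### The Wasserstein cost -/

/-- `W_c(μ, ν)`: the infimum of `∫ c dζ` over all transference plans `ζ` between `μ` and `ν`. -/
def wasserstein {X : Type*} [MeasurableSpace X] (c : X → X → ℝ) (μ ν : Measure X) : ENNReal :=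
  ⨅ ζ ∈ {ζ : Measure (X × X) | ζ.map Prod.fst = μ ∧ ζ.map Prod.snd = ν},
    ∫⁻ p, ENNReal.ofReal (c p.1 p.2) ∂ζ

open Classical in
/-- The indicator of the complement of the diagonal. -/
def offDiag {X : Type*} (x y : X) : ℝ := if x ≠ y then 1 else 0

/-- The cost `c(x, y) = 1_{x ≠ y} (1 + ‖x - y‖ / R)`. -/
def cost {d : ℕ} (R : ℝ) (x y : EuclideanSpace ℝ (Fin d)) : ℝ :=
  offDiag x y * (1 + ‖x - y‖ / R)

/-! ### The explicit constants

They depend on the one-sided Lipschitz constant `m`, the strong dissipativity constant `mp`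
(written `m⁺`), the Lipschitz constant `L`, the radius `R`, the largest stepsize `γbar` and a free
integer parameter `ℓ ≥ 1`. A one-sided Lipschitz condition with constant `m > 0` is used only
through its consequence with constant `0`, whence the `min m 0`. -/

/-- The cumulative distribution function of the standard normal distribution on `ℝ`. -/
def Phi (t : ℝ) : ℝ := cdf (gaussianReal 0 1) t

/-- `κ(γ) = -2 m + γ L²`, with `m` replaced by `min m 0`. -/
def kappa (m L γ : ℝ) : ℝ := -2 * min m 0 + γ * L ^ 2

/-- `Ξ_n = γ ∑_{k=1}^n (1 + γ κ(γ))^{-k}`. -/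
def Xi (m L γ : ℝ) (n : ℕ) : ℝ :=
  γ * ∑ k ∈ Finset.Icc 1 n, ((1 + γ * kappa m L γ) ^ k)⁻¹

/-- `ε = inf_{0 < γ ≤ γbar} 2 Φ(-R / (2 √Ξ_{ℓ⌈1/γ⌉}))`. -/
def eps (m L R γbar : ℝ) (ℓ : ℕ) : ℝ :=
  ⨅ γ : Set.Ioc (0 : ℝ) γbar, 2 * Phi (-(R / (2 * √(Xi m L γ (ℓ * ⌈1 / (γ : ℝ)⌉₊)))))

/-- The rate `λ = exp(-(m⁺ - γbar L² / 2) / 2)`. -/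
def rateLambda (mp L γbar : ℝ) : ℝ := Real.exp (-(mp - γbar * L ^ 2 / 2) / 2)

/-- `A = m⁺ - m`, with `m` replaced by `min m 0`. -/
def driftA (m mp : ℝ) : ℝ := mp - min m 0

/-- `A λ^{-(1 + γbar) ℓ} (1 + γbar) ℓ`. -/
def driftSum (m mp L γbar : ℝ) (ℓ : ℕ) : ℝ :=
  driftA m mp * rateLambda mp L γbar ^ (-((1 + γbar) * ℓ)) * ((1 + γbar) * ℓ)

/-- `c̄ = 2 + A λ^{-(1 + γbar) ℓ} (1 + γbar) ℓ`, where `2` is the largest value of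
`1 + ‖x - y‖ / R` on `‖x - y‖ ≤ R`. -/
def cBar (m mp L γbar : ℝ) (ℓ : ℕ) : ℝ := 2 + driftSum m mp L γbar ℓ

/-- The rate `ρ`, given by `log ρ = log λ · log (1 - ε) / (-log c̄ + log (1 - ε))`. -/
def rateRho (m mp L R γbar : ℝ) (ℓ : ℕ) : ℝ :=
  Real.exp (Real.log (rateLambda mp L γbar) * Real.log (1 - eps m L R γbar ℓ) /
    (-Real.log (cBar m mp L γbar ℓ) + Real.log (1 - eps m L R γbar ℓ)))

/-- `D₁ = 1 + 4 A / (log(1/λ) λ^γbar)`. -/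
def constD1 (m mp L γbar : ℝ) : ℝ :=
  1 + 4 * driftA m mp /
    (Real.log (1 / rateLambda mp L γbar) * rateLambda mp L γbar ^ γbar)

/-- `D₂ = D₁ A λ^{-(1 + γbar) ℓ} (1 + γbar) ℓ`. -/
def constD2 (m mp L γbar : ℝ) (ℓ : ℕ) : ℝ := constD1 m mp L γbar * driftSum m mp L γbar ℓ

/-- `E = 8 A / (log(1/ρ) ρ^γbar)`. -/
def constE (m mp L R γbar : ℝ) (ℓ : ℕ) : ℝ :=
  8 * driftA m mp /
    (Real.log (1 / rateRho m mp L R γbar ℓ) * rateRho m mp L R γbar ℓ ^ γbar)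

end

end EulerMaruyama

/-!
The proof runs two copies of the chain from `x` and `y` and bounds the Wasserstein cost by the
expected cost under this coupling.

Let `T x = x + γ b x`. In one step the Gaussian increments of the two copies are mirror images of
each other in the hyperplane orthogonal to `T x - T y`, except that the copies are made to coincide
with the largest probability that the two Gaussian laws allow, `min 1` of the ratio of their
densities. Once together, the copies stay together. The ratio of the densities is given by the
Cameron–Martin formula (`stdGaussian_withDensity_shiftDensity`), and the second marginal is right
because the reflection exchanges the two Gaussian laws (`lintegral_coupledMove_snd`).

Everything that is needed about one step is contained in `lintegral_coupledMove_le`. If the copies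
do not merge, half their signed distance along `T x - T y` is `‖T x - T y‖ / 2 + √γ ξ` with `ξ` a
standard real Gaussian, and it is nonnegative; and the moves that merge are symmetric with respect
to the midpoint, so they do not contribute to the integral of an odd function `f` of this number.
Hence the integral of `f` over the moves that do not merge is a one-dimensional Gaussian integral.
* For `f` linear, the expected distance after the step is `‖T x - T y‖`. The hypotheses on the drift
  turn this into the drift condition: the cost contracts by `λ ^ γ` at distance at least `R`
  (`cost_step_le_of_le`), and up to `γ A` at distance less than `R` (`cost_step_le_of_lt`).
* For `f t = N(0, v) (-t, t]`, the Gaussian integral has the same form with the variance `v + γ`.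
  By induction the probability of not having met after `n` steps is at most
  `N(0, Ξ_n) (-q / 2, q / 2]` with `q = ‖x - y‖` (`chainCoupling_pow_apart_le`), which gives the
  minorization condition: from distance less than `R`, the copies have met after `ℓ ⌈1/γ⌉` steps
  with probability at least `ε`.

The two conditions are combined for a general Markov kernel. Call an excursion a run of `ℓ ⌈1/γ⌉`
steps from a pair at distance less than `R`, continued until the next visit to such pairs. Each
excursion is survived with probability at most `1 - ε`, and it increases the expectation of
`λ ^ (- γ · time)` times the cost at most by the factor `c̄`. So the probability of being apart at
time `k` is, for every `j`, at most `(1 - ε) ^ j + λ ^ (γ k) c̄ ^ j` from a pair at distance less than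
`R` (`measure_pow_le_excursions`). The definition of `ρ` balances the two terms, and half of the time
`k` is reserved for reaching distance less than `R` (`measure_pow_le_of_reach`). The resulting bound
for the survival probability (`chainCoupling_survival_le`) is put into the iterated drift condition,
`lintegral_pow_le_drift`, where the sum over time is a convolution of geometric sequences; summing it
produces the denominators `log (1/λ) λ ^ γbar` and `log (1/ρ) ρ ^ γbar` of the constants.
-/

open MeasureTheory ProbabilityTheory

namespace EulerMaruyama

variable {d : ℕ}

local notation "𝔼" => EuclideanSpace ℝ (Fin d)

/-! ### The standard Gaussian measure: translations, symmetries, marginals -/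

/-- A linear form of a standard Gaussian vector is a centred real Gaussian. -/
theorem stdGaussian_map_inner (e : 𝔼) :
    (stdGaussian 𝔼).map (fun z => inner ℝ e z) = gaussianReal 0 (‖e‖ ^ 2).toNNReal := by
  have h := IsGaussian.map_eq_gaussianReal (μ := stdGaussian 𝔼) (innerSL ℝ e)
  rw [variance_dual_stdGaussian, integral_strongDual_stdGaussian, innerSL_apply_norm] at h
  exact h

theorem stdGaussian_map_neg : (stdGaussian 𝔼).map (fun z => -z) = stdGaussian 𝔼 :=
  stdGaussian_map (LinearIsometryEquiv.neg ℝ (E := 𝔼))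

/-- The Cameron–Martin density of the translate of the standard Gaussian measure by `-w`. -/
noncomputable def shiftDensity (w z : 𝔼) : ℝ := Real.exp (-inner ℝ w z - ‖w‖ ^ 2 / 2)

theorem shiftDensity_pos (w z : 𝔼) : 0 < shiftDensity w z := Real.exp_pos _

theorem integrable_shiftDensity (w : 𝔼) : Integrable (shiftDensity w) (stdGaussian 𝔼) := by
  have h : Integrable (fun t : ℝ => Real.exp (-1 * t))
      ((stdGaussian 𝔼).map (fun z => inner ℝ w z)) := by
    rw [stdGaussian_map_inner]
    exact integrable_exp_mul_gaussianReal (-1)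
  have h2 := (h.comp_measurable (by fun_prop)).mul_const (Real.exp (-‖w‖ ^ 2 / 2))
  refine h2.congr (.of_forall fun z => ?_)
  simp only [Function.comp, shiftDensity, ← Real.exp_add]
  ring_nf

@[fun_prop]
theorem measurable_shiftDensity (w : 𝔼) : Measurable (shiftDensity w) := by
  unfold shiftDensity; fun_prop

/-- **Cameron–Martin** for the standard Gaussian measure, by comparing characteristic functions
coordinate by coordinate. -/
theorem stdGaussian_withDensity_shiftDensity (w : 𝔼) :
    (stdGaussian 𝔼).withDensity (fun z => ENNReal.ofReal (shiftDensity w z)) =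
      (stdGaussian 𝔼).map (fun z => z - w) := by
  have : IsFiniteMeasure ((stdGaussian 𝔼).withDensity
      (fun z => ENNReal.ofReal (shiftDensity w z))) :=
    isFiniteMeasure_withDensity_ofReal (integrable_shiftDensity w).2
  have : IsProbabilityMeasure ((stdGaussian 𝔼).map (fun z => z - w)) :=
    Measure.isProbabilityMeasure_map (by fun_prop)
  apply Measure.ext_of_charFun
  ext t
  rw [charFun_apply, integral_withDensity_eq_integral_toReal_smul (by fun_prop)
    (.of_forall fun _ => ENNReal.ofReal_lt_top)]
  have hshift : charFun ((stdGaussian 𝔼).map (fun z => z - w)) t =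
      Complex.exp (-inner ℝ w t * Complex.I) * charFun (stdGaussian 𝔼) t := by
    rw [charFun_apply, integral_map (by fun_prop) (by fun_prop), charFun_apply,
      ← integral_const_mul]
    refine integral_congr_ae (.of_forall fun z => ?_)
    simp only [inner_sub_left, ← Complex.exp_add]
    push_cast
    ring_nf
  rw [hshift, charFun_stdGaussian, ← map_pi_eq_stdGaussian, integral_map (by fun_prop)
    (Measurable.aestronglyMeasurable (by fun_prop))]
  have hprod : ∀ x : Fin d → ℝ,
      (ENNReal.ofReal (shiftDensity w (WithLp.toLp 2 x))).toReal •
        Complex.exp (inner ℝ (WithLp.toLp 2 x) t * Complex.I) =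
      ∏ i, Complex.exp ((-w i + t i * Complex.I) * x i - w i ^ 2 / 2) := by
    intro x
    rw [ENNReal.toReal_ofReal (shiftDensity_pos _ _).le, shiftDensity, Complex.real_smul,
      Complex.ofReal_exp, ← Complex.exp_add, ← Complex.exp_sum, EuclideanSpace.real_norm_sq_eq]
    congr 1
    simp only [PiLp.inner_apply, RCLike.inner_apply, conj_trivial]
    push_cast
    rw [Finset.sum_div, Finset.sum_mul, ← Finset.sum_neg_distrib, ← Finset.sum_sub_distrib,
      ← Finset.sum_add_distrib]
    refine Finset.sum_congr rfl fun i _ => ?_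
    ring
  simp_rw [hprod]
  rw [integral_fintype_prod_eq_prod
    (f := fun i (x : ℝ) => Complex.exp ((-w i + t i * Complex.I) * x - w i ^ 2 / 2))]
  have hone : ∀ i, ∫ x : ℝ, Complex.exp ((-w i + t i * Complex.I) * x - w i ^ 2 / 2)
      ∂gaussianReal 0 1 = Complex.exp (-(w i * t i) * Complex.I - t i ^ 2 / 2) := by
    intro i
    have h := complexMGF_id_gaussianReal (μ := 0) (v := 1) (-w i + t i * Complex.I : ℂ)
    rw [complexMGF] at h
    simp_rw [sub_eq_add_neg _ ((_ : ℂ) / 2), Complex.exp_add]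
    rw [integral_mul_const]
    simp only [id] at h
    rw [h, ← Complex.exp_add, ← Complex.exp_add]
    congr 1
    have := Complex.I_sq
    push_cast
    linear_combination (t i : ℂ) ^ 2 / 2 * this
  simp_rw [hone]
  rw [← Complex.exp_sum, ← Complex.exp_add, ← Complex.ofReal_pow, EuclideanSpace.real_norm_sq_eq]
  congr 1
  simp only [PiLp.inner_apply, RCLike.inner_apply, conj_trivial]
  push_cast
  rw [← Finset.sum_neg_distrib, ← Finset.sum_neg_distrib, Finset.sum_div, Finset.sum_mul,
    ← Finset.sum_add_distrib]
  refine Finset.sum_congr rfl fun i _ => ?_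
  ring

/-- The acceptance probability of the maximal coupling of `N(0, Id)` and `N(-w, Id)`: the
ratio of the two densities at `z`, truncated at `1`. -/
noncomputable def accept (w z : 𝔼) : ℝ := min 1 (shiftDensity w z)

theorem accept_nonneg (w z : 𝔼) : 0 ≤ accept w z := le_min zero_le_one (shiftDensity_pos w z).le

theorem accept_le_one (w z : 𝔼) : accept w z ≤ 1 := min_le_left _ _

theorem measurable_accept (w : 𝔼) : Measurable (accept w) := by
  unfold accept; fun_prop

/-- The involution `z ↦ -z - w` exchanges the two Gaussian densities, hence inverts their ratio. -/
theorem accept_eq_mul (w z : 𝔼) :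
    accept w z = shiftDensity w z * accept w (-z - w) := by
  have h : shiftDensity w (-z - w) = (shiftDensity w z)⁻¹ := by
    simp only [shiftDensity, inner_sub_right, inner_neg_right, real_inner_self_eq_norm_sq,
      ← Real.exp_neg]
    ring_nf
  have hpos := shiftDensity_pos w z
  rw [accept, accept, h, mul_min_of_nonneg _ _ hpos.le, mul_one, mul_inv_cancel₀ hpos.ne', min_comm]

theorem lintegral_accept_mul_comp_add (w : 𝔼) {h : 𝔼 → ENNReal} (hh : Measurable h) :
    ∫⁻ z, ENNReal.ofReal (accept w z) * h (z + w) ∂stdGaussian 𝔼 =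
      ∫⁻ z, ENNReal.ofReal (accept w (-z)) * h z ∂stdGaussian 𝔼 := by
  have hm := measurable_accept w
  calc _ = ∫⁻ z, ENNReal.ofReal (accept w (-z - w)) * h (z + w)
        ∂(stdGaussian 𝔼).withDensity (fun z => ENNReal.ofReal (shiftDensity w z)) := by
        rw [lintegral_withDensity_eq_lintegral_mul _ (by fun_prop) (by fun_prop)]
        refine lintegral_congr fun z => ?_
        rw [accept_eq_mul w z, ENNReal.ofReal_mul (shiftDensity_pos _ _).le, Pi.mul_apply, mul_assoc]
    _ = _ := by
        rw [stdGaussian_withDensity_shiftDensity, lintegral_map (by fun_prop) (by fun_prop)]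
        simp

/-- The accepted moves do not contribute to the integral of a function that is odd with respect to
the midpoint of the two Gaussians. -/
theorem integral_accept_mul_eq_zero (w : 𝔼) {F : 𝔼 → ℝ} (hF : ∀ z, F (-z - w) = -F z) :
    ∫ z, accept w z * F z ∂stdGaussian 𝔼 = 0 := by
  have h : ∫ z, accept w z * F z ∂stdGaussian 𝔼 = -∫ z, accept w z * F z ∂stdGaussian 𝔼 := by
    calc _ = ∫ z, accept w (-z - w) * F z
          ∂(stdGaussian 𝔼).withDensity (fun z => ENNReal.ofReal (shiftDensity w z)) := by
          rw [integral_withDensity_eq_integral_toReal_smul (by fun_prop)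
            (.of_forall fun _ => ENNReal.ofReal_lt_top)]
          refine integral_congr_ae (.of_forall fun z => ?_)
          simp only
          rw [accept_eq_mul w z, ENNReal.toReal_ofReal (shiftDensity_pos _ _).le, smul_eq_mul, mul_assoc]
      _ = ∫ z, accept w (-z) * F (z - w) ∂stdGaussian 𝔼 := by
          rw [stdGaussian_withDensity_shiftDensity]
          have h := (Homeomorph.subRight w).measurableEmbedding.integral_map
            (μ := stdGaussian 𝔼) (fun z => accept w (-z - w) * F z)
          refine h.trans ?_
          simp [Homeomorph.subRight]
      _ = ∫ z, accept w (-z) * F (z - w) ∂(stdGaussian 𝔼).map (fun z => -z) := by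
          rw [stdGaussian_map_neg]
      _ = _ := by
          have h := (Homeomorph.neg 𝔼).measurableEmbedding.integral_map
            (μ := stdGaussian 𝔼) (fun z => accept w (-z) * F (z - w))
          simpa [hF, integral_neg] using h
  linarith

/-! ### The maximal reflection coupling of two Gaussian moves -/

/-- The reflected move: from `p.2`, the increment is the mirror image of `s • z` in the hyperplane
orthogonal to `p.1 - p.2`. For `p.1 = p.2` the division by zero makes it the plain move. -/
noncomputable def reflectedMove (s : ℝ) (p : 𝔼 × 𝔼) (z : 𝔼) : 𝔼 :=
  p.2 + s • (z - (2 * (inner ℝ (p.1 - p.2) z / ‖p.1 - p.2‖ ^ 2)) • (p.1 - p.2))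

/-- The probability that the moves of `p.1` and `p.2` are made to coincide, given that the first one
goes to `p.1 + s • z`. -/
noncomputable def mergeProb (s : ℝ) (p : 𝔼 × 𝔼) (z : 𝔼) : ℝ :=
  accept (s⁻¹ • (p.1 - p.2)) z

@[fun_prop]
theorem measurable_mergeProb (s : ℝ) :
    Measurable (fun q : (𝔼 × 𝔼) × 𝔼 => mergeProb s q.1 q.2) := by
  unfold mergeProb accept shiftDensity
  fun_prop

@[fun_prop]
theorem measurable_reflectedMove (s : ℝ) :
    Measurable (fun q : (𝔼 × 𝔼) × 𝔼 => reflectedMove s q.1 q.2) := by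
  unfold reflectedMove
  fun_prop

@[fun_prop]
theorem measurable_mergeProb_right (s : ℝ) (p : 𝔼 × 𝔼) : Measurable (mergeProb s p) :=
  measurable_accept _

@[fun_prop]
theorem measurable_reflectedMove_right (s : ℝ) (p : 𝔼 × 𝔼) : Measurable (reflectedMove s p) := by
  unfold reflectedMove
  fun_prop

/-- The joint law of the coupled moves from `p.1` and `p.2`. -/
noncomputable def coupledMove (s : ℝ) (p : 𝔼 × 𝔼) : Measure (𝔼 × 𝔼) :=
  ((stdGaussian 𝔼).withDensity (fun z => ENNReal.ofReal (mergeProb s p z))).map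
      (fun z => (p.1 + s • z, p.1 + s • z)) +
    ((stdGaussian 𝔼).withDensity (fun z => ENNReal.ofReal (1 - mergeProb s p z))).map
      (fun z => (p.1 + s • z, reflectedMove s p z))

theorem lintegral_coupledMove (s : ℝ) (p : 𝔼 × 𝔼) {g : 𝔼 × 𝔼 → ENNReal} (hg : Measurable g) :
    ∫⁻ u, g u ∂coupledMove s p =
      ∫⁻ z, (ENNReal.ofReal (mergeProb s p z) * g (p.1 + s • z, p.1 + s • z) +
        ENNReal.ofReal (1 - mergeProb s p z) * g (p.1 + s • z, reflectedMove s p z))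
        ∂stdGaussian 𝔼 := by
  rw [coupledMove, lintegral_add_measure, lintegral_map hg (by fun_prop),
    lintegral_map hg (by fun_prop),
    lintegral_withDensity_eq_lintegral_mul _ (by fun_prop) (by fun_prop),
    lintegral_withDensity_eq_lintegral_mul _ (by fun_prop) (by fun_prop),
    ← lintegral_add_left (by fun_prop)]
  rfl

/-- The Markov kernel of the coupled moves. -/
noncomputable def coupledKernel (s : ℝ) : Kernel (𝔼 × 𝔼) (𝔼 × 𝔼) where
  toFun := coupledMove s
  measurable' := by
    refine Measure.measurable_of_measurable_coe _ fun A hA => ?_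
    have h : ∀ p : 𝔼 × 𝔼, coupledMove s p A = _ := fun p => by
      rw [← lintegral_indicator_one hA, lintegral_coupledMove s p (measurable_one.indicator hA)]
    simp_rw [h]
    have hm : Measurable (A.indicator (1 : 𝔼 × 𝔼 → ENNReal)) := measurable_one.indicator hA
    exact Measurable.lintegral_prod_right' (f := fun q : (𝔼 × 𝔼) × 𝔼 =>
      ENNReal.ofReal (mergeProb s q.1 q.2) *
        A.indicator (1 : 𝔼 × 𝔼 → ENNReal) (q.1.1 + s • q.2, q.1.1 + s • q.2) +
      ENNReal.ofReal (1 - mergeProb s q.1 q.2) *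
        A.indicator (1 : 𝔼 × 𝔼 → ENNReal) (q.1.1 + s • q.2, reflectedMove s q.1 q.2)) (by fun_prop)

theorem coupledKernel_apply (s : ℝ) (p : 𝔼 × 𝔼) : coupledKernel s p = coupledMove s p := rfl

theorem ofReal_mergeProb_add (s : ℝ) (p : 𝔼 × 𝔼) (z : 𝔼) :
    ENNReal.ofReal (mergeProb s p z) + ENNReal.ofReal (1 - mergeProb s p z) = 1 := by
  rw [mergeProb, ← ENNReal.ofReal_add (accept_nonneg _ _) (sub_nonneg.2 (accept_le_one _ _))]
  simp

theorem lintegral_coupledMove_fst (s : ℝ) (p : 𝔼 × 𝔼) {h : 𝔼 → ENNReal} (hh : Measurable h) :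
    ∫⁻ u, h u.1 ∂coupledMove s p = ∫⁻ z, h (p.1 + s • z) ∂stdGaussian 𝔼 := by
  rw [lintegral_coupledMove s p (by fun_prop)]
  refine lintegral_congr fun z => ?_
  rw [← add_mul, ofReal_mergeProb_add, one_mul]

instance (s : ℝ) : IsMarkovKernel (coupledKernel (d := d) s) := by
  refine ⟨fun p => ⟨?_⟩⟩
  have h := lintegral_coupledMove_fst s p (h := fun _ => 1) measurable_const
  simpa [coupledKernel_apply] using h

/-- The reflection in the hyperplane orthogonal to `v`; the identity for `v = 0`. -/
theorem reflection_orthogonal_singleton_apply (v z : 𝔼) :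
    (ℝ ∙ v)ᗮ.reflection z = z - (2 * (inner ℝ v z / ‖v‖ ^ 2)) • v := by
  rw [Submodule.reflection_orthogonal_apply, Submodule.reflection_singleton_apply, neg_sub,
    ← Nat.cast_smul_eq_nsmul ℝ, smul_smul]
  simp

theorem lintegral_coupledMove_snd {s : ℝ} (hs : s ≠ 0) (p : 𝔼 × 𝔼) {h : 𝔼 → ENNReal}
    (hh : Measurable h) :
    ∫⁻ u, h u.2 ∂coupledMove s p = ∫⁻ z, h (p.2 + s • z) ∂stdGaussian 𝔼 := by
  set w : 𝔼 := s⁻¹ • (p.1 - p.2) with hw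
  set S : 𝔼 ≃ₗᵢ[ℝ] 𝔼 := (ℝ ∙ (p.1 - p.2))ᗮ.reflection with hS
  have hmove : ∀ z, p.1 + s • z = p.2 + s • (z + w) := fun z => by
    rw [hw, smul_add, smul_inv_smul₀ hs]; abel
  have hrefl : ∀ z, reflectedMove s p z = p.2 + s • S z := fun z => by
    rw [reflectedMove, hS, reflection_orthogonal_singleton_apply]
  have hacc : ∀ z, accept w z = accept w (-S z) := fun z => by
    have h1 : S w = -w := by
      rw [hw, map_smul, hS, Submodule.reflection_orthogonalComplement_singleton_eq_neg, smul_neg]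
    have h2 : inner ℝ w (-S z) = inner ℝ w z := by
      rw [inner_neg_right, ← inner_neg_left, ← h1, S.inner_map_map]
    rw [accept, accept, shiftDensity, shiftDensity, h2]
  have hma := measurable_accept w
  rw [lintegral_coupledMove s p (by fun_prop), lintegral_add_left (by fun_prop)]
  have e1 : ∫⁻ z, ENNReal.ofReal (mergeProb s p z) * h (p.1 + s • z) ∂stdGaussian 𝔼 =
      ∫⁻ z, ENNReal.ofReal (accept w (-z)) * h (p.2 + s • z) ∂stdGaussian 𝔼 := by
    simp_rw [hmove]
    exact lintegral_accept_mul_comp_add w (h := fun z => h (p.2 + s • z)) (by fun_prop)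
  have e2 : ∫⁻ z, ENNReal.ofReal (1 - mergeProb s p z) * h (reflectedMove s p z)
        ∂stdGaussian 𝔼 =
      ∫⁻ z, ENNReal.ofReal (1 - accept w (-z)) * h (p.2 + s • z) ∂stdGaussian 𝔼 := by
    conv_rhs => rw [← stdGaussian_map S]
    rw [lintegral_map (by fun_prop) S.continuous.measurable]
    refine lintegral_congr fun z => ?_
    rw [hrefl, ← hacc]
    rfl
  rw [e1, e2, ← lintegral_add_left (by fun_prop)]
  refine lintegral_congr fun z => ?_
  rw [← add_mul, ← ENNReal.ofReal_add (accept_nonneg _ _) (sub_nonneg.2 (accept_le_one _ _))]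
  simp

/-- Moves from a common point stay together. -/
theorem lintegral_coupledMove_diag (s : ℝ) (x : 𝔼) {g : 𝔼 × 𝔼 → ENNReal} (hg : Measurable g)
    (hdiag : ∀ u, g (u, u) = 0) : ∫⁻ u, g u ∂coupledMove s (x, x) = 0 := by
  rw [lintegral_coupledMove s _ hg]
  simp [hdiag, mergeProb, accept, shiftDensity]

/-- The fundamental estimate for the reflection coupling. If the two moves do not merge, half their
signed distance along `p.1 - p.2` is the real Gaussian `‖p.1 - p.2‖ / 2 + s ξ`, and this number is
then nonnegative. The moves that merge contribute nothing to the integral of an odd function of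
it, by symmetry with respect to the midpoint, so that the integral over the others is the full
Gaussian integral. -/
theorem lintegral_coupledMove_le {s : ℝ} (hs : 0 < s) {p : 𝔼 × 𝔼} (hp : p.1 ≠ p.2) {f : ℝ → ℝ}
    (hodd : ∀ t, f (-t) = -f t) (hpos : ∀ t, 0 ≤ t → 0 ≤ f t)
    (hint : Integrable (fun t => f (‖p.1 - p.2‖ / 2 + s * t)) (gaussianReal 0 1))
    {g : 𝔼 × 𝔼 → ENNReal} (hg : Measurable g) (hdiag : ∀ u, g (u, u) = 0)
    (hle : ∀ u v, g (u, v) ≤ ENNReal.ofReal (f (‖u - v‖ / 2))) :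
    ∫⁻ u, g u ∂coupledMove s p ≤
      ENNReal.ofReal (∫ t, f (‖p.1 - p.2‖ / 2 + s * t) ∂gaussianReal 0 1) := by
  set v : 𝔼 := p.1 - p.2 with hv
  set r : ℝ := ‖v‖ with hr
  have hr0 : 0 < r := norm_pos_iff.2 (sub_ne_zero.2 hp)
  set w : 𝔼 := s⁻¹ • v with hw
  set ξ : 𝔼 → ℝ := fun z => inner ℝ (r⁻¹ • v) z with hξ
  have hlaw : (stdGaussian 𝔼).map ξ = gaussianReal 0 1 := by
    rw [hξ, stdGaussian_map_inner, norm_smul, ← hr, norm_inv, norm_norm, inv_mul_cancel₀ hr0.ne']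
    simp
  have hξm : Measurable ξ := by fun_prop
  have hvz : ∀ z, inner ℝ v z = r * ξ z := fun z => by
    rw [hξ]; simp only [inner_smul_left, conj_trivial]; field_simp
  have hwz : ∀ z, inner ℝ w z = r / s * ξ z := fun z => by
    rw [hw, inner_smul_left, hvz, conj_trivial]; ring
  set F : 𝔼 → ℝ := fun z => f (r / 2 + s * ξ z) with hF
  have hFodd : ∀ z, F (-z - w) = -F z := fun z => by
    have h1 : ξ (-z - w) = -ξ z - r / s := by
      have : ξ w = r / s := by
        rw [hξ]; simp only [hw, inner_smul_left, inner_smul_right, conj_trivial,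
          real_inner_self_eq_norm_sq, ← hr]
        field_simp
      simp only [hξ, inner_sub_right, inner_neg_right] at this ⊢
      rw [this]
    simp only [hF]
    rw [h1, ← hodd]
    congr 1
    field_simp
    ring
  have hFint : Integrable F (stdGaussian 𝔼) := by
    rw [← hlaw] at hint
    exact hint.comp_measurable hξm
  have hFeq : ∫ z, F z ∂stdGaussian 𝔼 = ∫ t, f (r / 2 + s * t) ∂gaussianReal 0 1 := by
    rw [← hlaw] at hint ⊢
    rw [integral_map hξm.aemeasurable hint.1]
  have hAint : Integrable (fun z => accept w z * F z) (stdGaussian 𝔼) :=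
    hFint.bdd_mul (c := 1) (measurable_accept w).aestronglyMeasurable (.of_forall fun z => by
      rw [Real.norm_of_nonneg (accept_nonneg _ _)]; exact accept_le_one _ _)
  have hmain : ∫ z, (1 - accept w z) * F z ∂stdGaussian 𝔼 =
      ∫ t, f (r / 2 + s * t) ∂gaussianReal 0 1 := by
    simp_rw [sub_mul, one_mul]
    rw [integral_sub hFint hAint, integral_accept_mul_eq_zero w hFodd, sub_zero, hFeq]
  have hmerge : ∀ z, r / 2 + s * ξ z < 0 → accept w z = 1 := fun z hz => by
    refine min_eq_left (Real.one_le_exp ?_)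
    have hnw : ‖w‖ = r / s := by
      rw [hw, norm_smul, norm_inv, Real.norm_of_nonneg hs.le, ← hr]; ring
    rw [hwz, hnw]
    have : -(r / s * ξ z) - (r / s) ^ 2 / 2 = r / s ^ 2 * -(r / 2 + s * ξ z) := by
      field_simp
      ring
    rw [this]
    exact mul_nonneg (by positivity) (by linarith)
  have hnn : ∀ z, 0 ≤ (1 - accept w z) * F z := fun z => by
    rcases lt_or_ge (r / 2 + s * ξ z) 0 with h | h
    · simp [hmerge z h]
    · exact mul_nonneg (sub_nonneg.2 (accept_le_one _ _)) (hpos _ h)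
  rw [← hmain, ofReal_integral_eq_lintegral_ofReal
    ((hFint.sub hAint).congr (.of_forall fun z => by simp [sub_mul])) (.of_forall hnn),
    lintegral_coupledMove s p hg]
  refine lintegral_mono fun z => ?_
  rw [hdiag, mul_zero, zero_add, mergeProb, ← hv, ← hw,
    ENNReal.ofReal_mul (sub_nonneg.2 (accept_le_one _ _))]
  rcases lt_or_ge (r / 2 + s * ξ z) 0 with h | h
  · simp [hmerge z h]
  · have hdist : ‖p.1 + s • z - reflectedMove s p z‖ / 2 = r / 2 + s * ξ z := by
      have h1 : p.1 + s • z - reflectedMove s p z = (1 + s * (2 * (ξ z / r))) • v := by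
        rw [reflectedMove, ← hv, ← hr, hvz, add_smul, one_smul, smul_sub, smul_smul]
        have : r * ξ z / r ^ 2 = ξ z / r := by field_simp
        rw [this, hv]
        abel
      have h2 : 1 + s * (2 * (ξ z / r)) = 2 / r * (r / 2 + s * ξ z) := by field_simp
      rw [h1, norm_smul, h2, Real.norm_of_nonneg (by positivity), ← hr]
      field_simp
    simp only [hF]
    rw [← hdist]
    gcongr
    exact hle _ _

/-! ### The Gaussian mass between `-t` and `t` -/

/-- `N(0, v) (-t, t]`, continued to an odd function of `t`. The variance `0` is allowed, and gives
the sign function. -/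
noncomputable def gaussSpread (v : NNReal) (t : ℝ) : ℝ :=
  (gaussianReal 0 v).real (Set.Iic t) - (gaussianReal 0 v).real (Set.Iic (-t))

theorem gaussSpread_neg (v : NNReal) (t : ℝ) : gaussSpread v (-t) = -gaussSpread v t := by
  simp [gaussSpread]

theorem gaussSpread_zero (v : NNReal) : gaussSpread v 0 = 0 := by simp [gaussSpread]

theorem monotone_gaussSpread (v : NNReal) : Monotone (gaussSpread v) := fun a b h =>
  sub_le_sub (measureReal_mono (Set.Iic_subset_Iic.2 h))
    (measureReal_mono (Set.Iic_subset_Iic.2 (neg_le_neg h)))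

theorem gaussSpread_nonneg (v : NNReal) {t : ℝ} (ht : 0 ≤ t) : 0 ≤ gaussSpread v t :=
  (gaussSpread_zero v).symm.le.trans (monotone_gaussSpread v ht)

theorem gaussSpread_zero_left {t : ℝ} (ht : 0 < t) : gaussSpread 0 t = 1 := by
  simp [gaussSpread, gaussianReal_zero_var, measureReal_def, ht, ht.le]

theorem measurable_gaussianReal_Iic (v : NNReal) :
    Measurable (fun t => (gaussianReal 0 v).real (Set.Iic t)) :=
  Monotone.measurable fun _ _ h => measureReal_mono (Set.Iic_subset_Iic.2 h)

theorem integrable_gaussianReal_Iic (v : NNReal) {u : ℝ → ℝ} (hu : Measurable u) :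
    Integrable (fun t => (gaussianReal 0 v).real (Set.Iic (u t))) (gaussianReal 0 1) :=
  Integrable.of_bound (C := 1)
    ((measurable_gaussianReal_Iic v).comp hu).aestronglyMeasurable (.of_forall fun t => by
    rw [Real.norm_of_nonneg measureReal_nonneg]; exact measureReal_le_one)

theorem integrable_gaussSpread (v : NNReal) (h s : ℝ) :
    Integrable (fun t => gaussSpread v (h + s * t)) (gaussianReal 0 1) :=
  (integrable_gaussianReal_Iic v (by fun_prop)).sub (integrable_gaussianReal_Iic v (by fun_prop))

theorem integral_gaussianReal_Iic (v : NNReal) (h s : ℝ) :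
    ∫ t, (gaussianReal 0 v).real (Set.Iic (h + s * t)) ∂gaussianReal 0 1 =
      (gaussianReal 0 (v + (s ^ 2).toNNReal)).real (Set.Iic h) := by
  have hmap : (gaussianReal 0 1).map (fun t => -s * t) = gaussianReal 0 (s ^ 2).toNNReal := by
    rw [gaussianReal_map_const_mul]
    congr 1
    · simp
    · ext; simp [Real.coe_toNNReal _ (sq_nonneg s)]
  have hconv : gaussianReal 0 (s ^ 2).toNNReal ∗ gaussianReal 0 v =
      gaussianReal 0 (v + (s ^ 2).toNNReal) := by
    rw [gaussianReal_conv_gaussianReal, zero_add, add_comm v]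
  simp_rw [measureReal_def]
  rw [integral_toReal (by
      have hm : Measurable fun t => gaussianReal 0 v (Set.Iic t) :=
        Monotone.measurable fun _ _ h => measure_mono (Set.Iic_subset_Iic.2 h)
      exact (hm.comp (by fun_prop : Measurable fun t => h + s * t)).aemeasurable)
      (.of_forall fun _ => measure_lt_top _ _),
    ← hconv, ← hmap, Measure.conv,
    Measure.map_apply (by fun_prop) measurableSet_Iic,
    Measure.prod_apply (measurableSet_Iic.preimage (by fun_prop)), lintegral_map
    (measurable_measure_prodMk_left (measurableSet_Iic.preimage (by fun_prop))) (by fun_prop)]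
  congr 1
  refine lintegral_congr fun t => ?_
  congr 1
  ext y
  simp only [Set.mem_Iic, Set.mem_preimage]
  constructor <;> intro _ <;> linarith

/-- Averaging over an independent Gaussian shift adds up the variances. -/
theorem integral_gaussSpread (v : NNReal) (h s : ℝ) :
    ∫ t, gaussSpread v (h + s * t) ∂gaussianReal 0 1 = gaussSpread (v + (s ^ 2).toNNReal) h := by
  simp only [gaussSpread]
  rw [integral_sub (integrable_gaussianReal_Iic v (by fun_prop))
    (integrable_gaussianReal_Iic v (by fun_prop)), integral_gaussianReal_Iic]
  have h2 := integral_gaussianReal_Iic v (-h) (-s)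
  rw [neg_sq] at h2
  rw [← h2]
  congr 2
  ext t
  ring_nf

theorem gaussianReal_Iic_mul {c : ℝ} (hc : 0 < c) (v : NNReal) (t : ℝ) :
    (gaussianReal 0 ((c ^ 2).toNNReal * v)).real (Set.Iic (c * t)) =
      (gaussianReal 0 v).real (Set.Iic t) := by
  have hmap : (gaussianReal 0 v).map (fun t => c * t) =
      gaussianReal 0 ((c ^ 2).toNNReal * v) := by
    rw [gaussianReal_map_const_mul]
    congr 1
    · simp
    · ext; simp [Real.coe_toNNReal _ (sq_nonneg c)]
  rw [← hmap, map_measureReal_apply (by fun_prop) measurableSet_Iic]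
  congr 1
  ext y
  exact mul_le_mul_iff_right₀ hc

theorem gaussSpread_mul {c : ℝ} (hc : 0 < c) (v : NNReal) (t : ℝ) :
    gaussSpread ((c ^ 2).toNNReal * v) (c * t) = gaussSpread v t := by
  simp only [gaussSpread, ← mul_neg, gaussianReal_Iic_mul hc]

theorem Phi_neg (t : ℝ) : Phi (-t) = 1 - Phi t := by
  have h1 : (gaussianReal 0 1).map (fun x => -x) = gaussianReal 0 1 := by
    rw [gaussianReal_map_neg, neg_zero]
  have := nullSingletonClass_gaussianReal (μ := 0) (v := 1) one_ne_zero
  rw [Phi, Phi, cdf_eq_real, cdf_eq_real, ← probReal_compl_eq_one_sub measurableSet_Iic,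
    Set.compl_Iic, measureReal_congr Ioi_ae_eq_Ici]
  conv_lhs => rw [← h1, map_measureReal_apply (by fun_prop) measurableSet_Iic]
  congr 1
  ext y
  simp

theorem gaussSpread_eq_one_sub_Phi {v : ℝ} (hv : 0 < v) (t : ℝ) :
    gaussSpread v.toNNReal t = 1 - 2 * Phi (-(t / √v)) := by
  have h := gaussSpread_mul (Real.sqrt_pos.2 hv) 1 (t / √v)
  rw [Real.sq_sqrt hv.le, mul_one, mul_div_cancel₀ _ (Real.sqrt_pos.2 hv).ne'] at h
  have h2 := Phi_neg (t / √v)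
  rw [h, gaussSpread, ← cdf_eq_real, ← cdf_eq_real]
  simp only [Phi] at h2 ⊢
  linarith

/-! ### Markov chains with a drift and a minorization condition -/

section Drift

variable {X : Type*} [MeasurableSpace X] (K : Kernel X X)

/-- Chapman–Kolmogorov, for integrals. -/
theorem lintegral_pow_add (i j : ℕ) (z : X) {f : X → ENNReal} (hf : Measurable f) :
    ∫⁻ u, f u ∂((K ^ (i + j)) z) = ∫⁻ u, (∫⁻ v, f v ∂((K ^ j) u)) ∂((K ^ i) z) := by
  rw [add_comm i j, Kernel.pow_add, Kernel.lintegral_comp _ _ _ hf]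

theorem lintegral_pow_zero (z : X) {f : X → ENNReal} (hf : Measurable f) :
    ∫⁻ u, f u ∂((K ^ 0) z) = f z := by
  rw [pow_zero, show (1 : Kernel X X) = Kernel.id from rfl, Kernel.id_apply, lintegral_dirac' _ hf]

theorem measure_pow_add (i j : ℕ) (z : X) {D : Set X} (hD : MeasurableSet D) :
    (K ^ (i + j)) z D = ∫⁻ u, (K ^ j) u D ∂((K ^ i) z) := by
  rw [add_comm i j, Kernel.pow_add, Kernel.comp_apply' _ _ _ hD]

instance [IsMarkovKernel K] (n : ℕ) : IsMarkovKernel (K ^ n) := by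
  induction n with
  | zero => rw [pow_zero]; exact inferInstanceAs (IsMarkovKernel (Kernel.id : Kernel X X))
  | succ n ih => rw [pow_succ]; exact inferInstanceAs (IsMarkovKernel ((K ^ n) ∘ₖ K))

variable {K} {V : X → ENNReal} {D C : Set X} {a b q S : ENNReal} {n : ℕ}

/-- Outside an absorbing complement of `D` the chain does not come back to `D`. -/
theorem measure_pow_eq_zero (hD : MeasurableSet D) (habs : ∀ z ∉ D, K z D = 0) (k : ℕ) {z : X}
    (hz : z ∉ D) : (K ^ k) z D = 0 := by
  induction k with
  | zero =>
    rw [pow_zero, show (1 : Kernel X X) = Kernel.id from rfl, Kernel.id_apply,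
      Measure.dirac_apply' _ hD, Set.indicator_of_notMem hz]
  | succ k ih =>
    rw [measure_pow_add K k 1 z hD, lintegral_eq_zero_iff (Kernel.measurable_coe _ hD), pow_one]
    filter_upwards [measure_eq_zero_iff_ae_notMem.1 ih] with u hu
    exact habs u hu

/-- The drift condition, iterated. -/
theorem lintegral_pow_le_drift (hV : Measurable V) (hD : MeasurableSet D)
    (hdrift : ∀ z, ∫⁻ u, V u ∂K z ≤ a * V z + b * D.indicator 1 z) (k : ℕ) (z : X) :
    ∫⁻ u, V u ∂((K ^ k) z) ≤
      a ^ k * V z + b * ∑ j ∈ Finset.range k, a ^ (k - 1 - j) * (K ^ j) z D := by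
  induction k with
  | zero => rw [lintegral_pow_zero _ _ hV]; simp
  | succ k ih =>
    calc ∫⁻ u, V u ∂((K ^ (k + 1)) z)
        = ∫⁻ u, (∫⁻ v, V v ∂K u) ∂((K ^ k) z) := by rw [lintegral_pow_add K k 1 z hV, pow_one]
      _ ≤ ∫⁻ u, (a * V u + b * D.indicator 1 u) ∂((K ^ k) z) := lintegral_mono hdrift
      _ = a * ∫⁻ u, V u ∂((K ^ k) z) + b * (K ^ k) z D := by
          rw [lintegral_add_left (by fun_prop), lintegral_const_mul _ hV,
            lintegral_const_mul _ (measurable_one.indicator hD), lintegral_indicator_one hD]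
      _ ≤ a * (a ^ k * V z + b * ∑ j ∈ Finset.range k, a ^ (k - 1 - j) * (K ^ j) z D) +
          b * (K ^ k) z D := by gcongr
      _ = _ := by
          have h : ∀ j ∈ Finset.range k,
              a ^ (k + 1 - 1 - j) * (K ^ j) z D = a * (a ^ (k - 1 - j) * (K ^ j) z D) := by
            intro j hj
            rw [show k + 1 - 1 - j = (k - 1 - j) + 1 by have := Finset.mem_range.1 hj; omega]
            ring
          rw [Finset.sum_range_succ, Finset.sum_congr rfl h, ← Finset.mul_sum]
          simp only [add_tsub_cancel_right, tsub_self, pow_zero, one_mul]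
          ring

/-- Over at most `n` steps the drift condition costs at most the additive constant `S`. -/
theorem lintegral_pow_le_of_le [IsMarkovKernel K] (hV : Measurable V) (hD : MeasurableSet D)
    (hdrift : ∀ z, ∫⁻ u, V u ∂K z ≤ a * V z + b * D.indicator 1 z)
    (hS : ∀ k ≤ n, b * ∑ j ∈ Finset.range k, a ^ j ≤ a ^ k * S) {k : ℕ} (hk : k ≤ n) (z : X) :
    ∫⁻ u, V u ∂((K ^ k) z) ≤ a ^ k * (V z + S) := by
  refine (lintegral_pow_le_drift hV hD hdrift k z).trans ?_
  rw [mul_add]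
  refine add_le_add le_rfl (le_trans ?_ (hS k hk))
  rw [← Finset.sum_range_reflect (fun j => a ^ j)]
  gcongr with j hj
  exact mul_le_of_le_one_right' prob_le_one

theorem measure_le_lintegral_of_one_le (hD : MeasurableSet D) (hV1 : ∀ z ∈ D, 1 ≤ V z)
    (μ : Measure X) : μ D ≤ ∫⁻ u, V u ∂μ := by
  rw [← lintegral_indicator_one hD]
  refine lintegral_mono fun u => ?_
  by_cases hu : u ∈ D
  · simpa [hu] using hV1 u hu
  · simp [hu]

/-- The probability of being in `D` at time `k` is at most the probability of having survived `j`
excursions from `C`, each with probability at most `q`, plus the probability that fewer than `j`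
excursions have been completed by then, which is small by the drift condition. -/
theorem measure_pow_le_excursions [IsMarkovKernel K] (hV : Measurable V) (hD : MeasurableSet D)
    (hCD : C ⊆ D) (habs : ∀ z ∉ D, K z D = 0) (hV1 : ∀ z ∈ D, 1 ≤ V z) (hVC : ∀ z ∈ C, V z ≤ 2)
    (hdrift : ∀ z, ∫⁻ u, V u ∂K z ≤ a * V z + b * D.indicator 1 z)
    (hdrift' : ∀ z ∉ C, ∫⁻ u, V u ∂K z ≤ a * V z)
    (hS : ∀ k ≤ n, b * ∑ j ∈ Finset.range k, a ^ j ≤ a ^ k * S)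
    (hmin : ∀ z ∈ C, (K ^ n) z D ≤ q) (j : ℕ) :
    (∀ z k, (K ^ k) z D ≤ q ^ j + a ^ k * (2 + S) ^ j * V z) ∧
      ∀ z ∈ C, ∀ k, (K ^ k) z D ≤ q ^ j + a ^ k * (2 + S) ^ j := by
  have h1S : (1 : ENNReal) ≤ 2 + S := le_add_right one_le_two
  induction j with
  | zero =>
    have h : ∀ z k, (K ^ k) z D ≤ 1 := fun _ _ => prob_le_one
    simp only [pow_zero]
    exact ⟨fun z k => le_add_right (h z k), fun z _ k => le_add_right (h z k)⟩
  | succ j ih =>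
    have hC : ∀ z ∈ C, ∀ k, (K ^ k) z D ≤ q ^ (j + 1) + a ^ k * (2 + S) ^ (j + 1) := by
      intro z hz k
      -- Either the first excursion is completed by time `k`, and the induction hypothesis applies
      -- after it, or `k ≤ n` and the drift alone gives the second term.
      rcases le_total n k with hnk | hkn
      · obtain ⟨i, rfl⟩ := Nat.exists_eq_add_of_le hnk
        calc (K ^ (n + i)) z D = ∫⁻ u, (K ^ i) u D ∂((K ^ n) z) := measure_pow_add K n i z hD
          _ ≤ ∫⁻ u, (q ^ j * D.indicator 1 u + a ^ i * (2 + S) ^ j * V u) ∂((K ^ n) z) := by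
              refine lintegral_mono fun u => ?_
              by_cases hu : u ∈ D
              · simpa [hu] using ih.1 u i
              · simp [measure_pow_eq_zero hD habs i hu]
          _ = q ^ j * (K ^ n) z D + a ^ i * (2 + S) ^ j * ∫⁻ u, V u ∂((K ^ n) z) := by
              rw [lintegral_add_right _ (by fun_prop), lintegral_const_mul _ hV,
                lintegral_const_mul _ (measurable_one.indicator hD), lintegral_indicator_one hD]
          _ ≤ q ^ j * q + a ^ i * (2 + S) ^ j * (a ^ n * (2 + S)) := by
              gcongr
              · exact hmin z hz
              · refine (lintegral_pow_le_of_le hV hD hdrift hS le_rfl z).trans ?_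
                gcongr
                exact hVC z hz
          _ = _ := by ring
      · calc (K ^ k) z D ≤ ∫⁻ u, V u ∂((K ^ k) z) := measure_le_lintegral_of_one_le hD hV1 _
          _ ≤ a ^ k * (V z + S) := lintegral_pow_le_of_le hV hD hdrift hS hkn z
          _ ≤ a ^ k * (2 + S) ^ (j + 1) := by
              gcongr
              refine le_trans ?_ (le_self_pow₀ h1S j.succ_ne_zero)
              gcongr
              exact hVC z hz
          _ ≤ _ := le_add_self
    refine ⟨fun z k => ?_, hC⟩
    -- Until `C` is reached, `V` shrinks by the factor `a` in each step.
    induction k generalizing z with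
    | zero =>
      by_cases hz : z ∈ D
      · calc (K ^ 0) z D ≤ 1 := prob_le_one
          _ ≤ a ^ 0 * (2 + S) ^ (j + 1) * V z := by
              rw [pow_zero, one_mul]
              exact one_le_mul (one_le_pow₀ h1S) (hV1 z hz)
          _ ≤ _ := le_add_self
      · rw [measure_pow_eq_zero hD habs 0 hz]
        exact zero_le
    | succ k ihk =>
      by_cases hz : z ∈ C
      · refine (hC z hz (k + 1)).trans ?_
        refine add_le_add le_rfl (le_mul_of_one_le_right' (hV1 z (hCD hz)))
      · calc (K ^ (k + 1)) z D = ∫⁻ u, (K ^ k) u D ∂K z := by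
              rw [add_comm, measure_pow_add K 1 k z hD, pow_one]
          _ ≤ ∫⁻ u, (q ^ (j + 1) + a ^ k * (2 + S) ^ (j + 1) * V u) ∂K z := lintegral_mono ihk
          _ = q ^ (j + 1) + a ^ k * (2 + S) ^ (j + 1) * ∫⁻ u, V u ∂K z := by
              rw [lintegral_add_right _ (by fun_prop), lintegral_const_mul _ hV, lintegral_const,
                measure_univ, mul_one]
          _ ≤ q ^ (j + 1) + a ^ k * (2 + S) ^ (j + 1) * (a * V z) := by
              gcongr
              exact hdrift' z hz
          _ = _ := by ring

/-- A bound `B` for the survival in `D` over the times `k` with `w k < 1`, valid from `C`, extends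
to all starting points with the additional term `w k * V z`, which accounts for the time to reach
`C`. -/
theorem measure_pow_le_of_reach [IsMarkovKernel K] (hV : Measurable V) (hD : MeasurableSet D)
    (habs : ∀ z ∉ D, K z D = 0) (hV1 : ∀ z ∈ D, 1 ≤ V z)
    (hdrift' : ∀ z ∉ C, ∫⁻ u, V u ∂K z ≤ a * V z) {w : ℕ → ENNReal} {B : ENNReal}
    (hw0 : 1 ≤ w 0) (hw : ∀ k, w k * a ≤ w (k + 1))
    (hB : ∀ k, 1 ≤ w k ∨ ∀ z ∈ C, (K ^ k) z D ≤ B) (k : ℕ) (z : X) :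
    (K ^ k) z D ≤ w k * V z + B := by
  have hbig : ∀ k z, 1 ≤ w k → (K ^ k) z D ≤ w k * V z + B := by
    intro k z hk
    by_cases hz : z ∈ D
    · calc (K ^ k) z D ≤ 1 := prob_le_one
        _ ≤ w k * V z := one_le_mul hk (hV1 z hz)
        _ ≤ _ := le_self_add
    · simp [measure_pow_eq_zero hD habs k hz]
  induction k generalizing z with
  | zero => exact hbig 0 z hw0
  | succ k ih =>
    rcases hB (k + 1) with hk | hk
    · exact hbig _ z hk
    by_cases hz : z ∈ C
    · exact (hk z hz).trans le_add_self
    · calc (K ^ (k + 1)) z D = ∫⁻ u, (K ^ k) u D ∂K z := by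
            rw [add_comm, measure_pow_add K 1 k z hD, pow_one]
        _ ≤ ∫⁻ u, (w k * V u + B) ∂K z := lintegral_mono ih
        _ = w k * ∫⁻ u, V u ∂K z + B := by
            rw [lintegral_add_right _ (by fun_prop), lintegral_const_mul _ hV, lintegral_const,
              measure_univ, mul_one]
        _ ≤ w k * (a * V z) + B := by
            gcongr
            exact hdrift' z hz
        _ = w k * a * V z + B := by ring
        _ ≤ _ := by gcongr; exact hw k

end Drift

/-! ### The coupled Euler–Maruyama chain -/

/-- The kernel of two Euler–Maruyama chains whose Gaussian increments are coupled by reflection and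
merged with the largest possible probability. -/
noncomputable def chainCoupling {b : 𝔼 → 𝔼} (hb : Measurable b) (γ : ℝ) :
    Kernel (𝔼 × 𝔼) (𝔼 × 𝔼) :=
  (coupledKernel √γ).comap (fun p => (p.1 + γ • b p.1, p.2 + γ • b p.2)) (by fun_prop)

variable {b : EuclideanSpace ℝ (Fin d) → EuclideanSpace ℝ (Fin d)} (hb : Measurable b) {γ : ℝ}

theorem chainCoupling_apply (γ : ℝ) (p : 𝔼 × 𝔼) :
    chainCoupling hb γ p = coupledMove √γ (p.1 + γ • b p.1, p.2 + γ • b p.2) := by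
  rw [chainCoupling, Kernel.comap_apply, coupledKernel_apply]

instance : IsMarkovKernel (chainCoupling hb γ) := by
  unfold chainCoupling; infer_instance

theorem lintegral_stepKernel (hb : Measurable b) (x : 𝔼) {h : 𝔼 → ENNReal} (hh : Measurable h) :
    ∫⁻ u, h u ∂stepKernel b γ x = ∫⁻ z, h (x + γ • b x + √γ • z) ∂stdGaussian 𝔼 := by
  rw [stepKernel_apply hb, lintegral_map hh (by fun_prop)]

/-- A function that intertwines two kernels intertwines their powers. -/
theorem lintegral_pow_comp {X Y : Type*} [MeasurableSpace X] [MeasurableSpace Y] {K : Kernel X X}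
    {P : Kernel Y Y} {π : X → Y} (hπ : Measurable π)
    (h : ∀ g : Y → ENNReal, Measurable g → ∀ z, ∫⁻ u, g (π u) ∂K z = ∫⁻ u, g u ∂P (π z))
    (k : ℕ) {g : Y → ENNReal} (hg : Measurable g) (z : X) :
    ∫⁻ u, g (π u) ∂((K ^ k) z) = ∫⁻ u, g u ∂((P ^ k) (π z)) := by
  have hgπ : Measurable fun u => g (π u) := hg.comp hπ
  induction k generalizing z with
  | zero => rw [lintegral_pow_zero _ _ hgπ, lintegral_pow_zero _ _ hg]
  | succ k ih =>
    rw [add_comm, lintegral_pow_add _ 1 k _ hgπ, lintegral_pow_add _ 1 k _ hg]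
    simp_rw [ih, pow_one]
    exact h _ hg.lintegral_kernel z

theorem chainCoupling_pow_map_fst (k : ℕ) (z : 𝔼 × 𝔼) :
    ((chainCoupling hb γ ^ k) z).map Prod.fst = (stepKernel b γ ^ k) z.1 := by
  refine Measure.ext_of_lintegral _ fun g hg => ?_
  rw [lintegral_map hg measurable_fst]
  refine lintegral_pow_comp measurable_fst (fun g hg z => ?_) k hg z
  rw [chainCoupling_apply, lintegral_coupledMove_fst _ _ hg, lintegral_stepKernel hb _ hg]

theorem chainCoupling_pow_map_snd (hγ : 0 < γ) (k : ℕ) (z : 𝔼 × 𝔼) :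
    ((chainCoupling hb γ ^ k) z).map Prod.snd = (stepKernel b γ ^ k) z.2 := by
  refine Measure.ext_of_lintegral _ fun g hg => ?_
  rw [lintegral_map hg measurable_snd]
  refine lintegral_pow_comp measurable_snd (fun g hg z => ?_) k hg z
  rw [chainCoupling_apply, lintegral_coupledMove_snd (Real.sqrt_pos.2 hγ).ne' _ hg,
    lintegral_stepKernel hb _ hg]

theorem wasserstein_le_lintegral_chainCoupling (hγ : 0 < γ) (R : ℝ) (x y : 𝔼) (k : ℕ) :
    wasserstein (cost R) ((stepKernel b γ ^ k) x) ((stepKernel b γ ^ k) y) ≤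
      ∫⁻ u, ENNReal.ofReal (cost R u.1 u.2) ∂((chainCoupling hb γ ^ k) (x, y)) :=
  iInf₂_le _ ⟨chainCoupling_pow_map_fst hb k (x, y), chainCoupling_pow_map_snd hb hγ k (x, y)⟩

/-- The pairs of distinct points. -/
def apart : Set (𝔼 × 𝔼) := {p | p.1 ≠ p.2}

theorem measurableSet_apart : MeasurableSet (apart (d := d)) :=
  (measurableSet_eq_fun measurable_fst measurable_snd).compl

theorem chainCoupling_apart_eq_zero (γ : ℝ) {p : 𝔼 × 𝔼} (hp : p ∉ apart) :
    chainCoupling hb γ p apart = 0 := by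
  obtain ⟨x, y⟩ := p
  obtain rfl : x = y := by simpa [apart] using hp
  rw [chainCoupling_apply, ← lintegral_indicator_one measurableSet_apart]
  exact lintegral_coupledMove_diag _ _ (measurable_one.indicator measurableSet_apart)
    fun u => by simp [apart]

/-! ### One step of the drift -/

/-- A one-sided Lipschitz bound and a Lipschitz bound for `b` control the explicit Euler step. -/
theorem norm_step_sub_sq_le {L m' : ℝ} (hγ : 0 < γ) {x y : 𝔼}
    (hLip : ‖b x - b y‖ ≤ L * ‖x - y‖)
    (hm : inner ℝ (b x - b y) (x - y) ≤ -m' * ‖x - y‖ ^ 2) :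
    ‖(x + γ • b x) - (y + γ • b y)‖ ^ 2 ≤ (1 - 2 * γ * m' + γ ^ 2 * L ^ 2) * ‖x - y‖ ^ 2 := by
  have h : (x + γ • b x) - (y + γ • b y) = (x - y) + γ • (b x - b y) := by
    rw [smul_sub]; abel
  rw [h, norm_add_sq_real, inner_smul_right, real_inner_comm, norm_smul, mul_pow,
    Real.norm_of_nonneg hγ.le]
  have h2 : ‖b x - b y‖ ^ 2 ≤ (L * ‖x - y‖) ^ 2 := by gcongr
  nlinarith [mul_le_mul_of_nonneg_left h2 (sq_nonneg γ), mul_le_mul_of_nonneg_left hm hγ.le]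

/-- The cost after one coupled step: the distance has the expectation `‖T x - T y‖`, where
`T x = x + γ b x`. -/
theorem lintegral_cost_chainCoupling_le (hγ : 0 < γ) {R : ℝ} (hR : 0 < R) (x y : 𝔼) :
    ∫⁻ u, ENNReal.ofReal (cost R u.1 u.2) ∂chainCoupling hb γ (x, y) ≤
      ENNReal.ofReal (1 + ‖(x + γ • b x) - (y + γ • b y)‖ / R) := by
  have hs := Real.sqrt_pos.2 hγ
  set p : 𝔼 × 𝔼 := (x + γ • b x, y + γ • b y) with hp
  have hle : ∀ u : 𝔼 × 𝔼, ENNReal.ofReal (cost R u.1 u.2) ≤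
      1 + ENNReal.ofReal (2 / R * (‖u.1 - u.2‖ / 2)) := fun u => by
    rw [← ENNReal.ofReal_one, ← ENNReal.ofReal_add zero_le_one (by positivity)]
    refine ENNReal.ofReal_le_ofReal ?_
    have : 2 / R * (‖u.1 - u.2‖ / 2) = ‖u.1 - u.2‖ / R := by field_simp
    rw [this, cost, offDiag]
    split_ifs
    · rw [one_mul]
    · rw [zero_mul]; positivity
  have hlin : ∫⁻ u, ENNReal.ofReal (2 / R * (‖u.1 - u.2‖ / 2)) ∂coupledMove √γ p ≤
      ENNReal.ofReal (‖p.1 - p.2‖ / R) := by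
    by_cases h : p.1 = p.2
    · have : p = (p.1, p.1) := Prod.ext rfl h.symm
      rw [this, lintegral_coupledMove_diag _ _ (by fun_prop) (by simp)]
      exact zero_le
    · have hid : Integrable (fun t : ℝ => t) (gaussianReal 0 1) :=
        (memLp_id_gaussianReal 1).integrable le_rfl
      have hint : Integrable (fun t => 2 / R * (‖p.1 - p.2‖ / 2 + √γ * t)) (gaussianReal 0 1) :=
        ((integrable_const _).add (hid.const_mul _)).const_mul _
      refine (lintegral_coupledMove_le hs h (f := fun t => 2 / R * t) (by simp)
        (fun t ht => by positivity) hint (by fun_prop) (by simp) (by simp)).trans ?_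
      refine ENNReal.ofReal_le_ofReal (le_of_eq ?_)
      rw [integral_const_mul, integral_add (integrable_const _) (hid.const_mul _),
        integral_const_mul, integral_id_gaussianReal]
      simp [field]
  rw [chainCoupling_apply, ENNReal.ofReal_add zero_le_one (by positivity), ENNReal.ofReal_one]
  calc _ ≤ ∫⁻ u, (1 + ENNReal.ofReal (2 / R * (‖u.1 - u.2‖ / 2))) ∂coupledMove √γ p :=
        lintegral_mono hle
    _ = 1 + ∫⁻ u, ENNReal.ofReal (2 / R * (‖u.1 - u.2‖ / 2)) ∂coupledMove √γ p := by
        rw [← coupledKernel_apply, lintegral_add_left measurable_const, lintegral_const,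
          measure_univ, mul_one]
    _ ≤ _ := by gcongr

/-! ### Merging of the coupled chains -/

theorem kappa_nonneg (m L : ℝ) {γ : ℝ} (hγ : 0 < γ) : 0 ≤ kappa m L γ := by
  have := min_le_right m 0
  unfold kappa
  nlinarith [sq_nonneg L]

theorem Xi_nonneg (m L : ℝ) (hγ : 0 < γ) (n : ℕ) : 0 ≤ Xi m L γ n := by
  have := kappa_nonneg m L hγ
  unfold Xi
  positivity

theorem mul_Xi_succ (m L : ℝ) (hγ : 0 < γ) (n : ℕ) :
    (1 + γ * kappa m L γ) * Xi m L γ (n + 1) = Xi m L γ n + γ := by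
  have hκ := kappa_nonneg m L hγ
  have hc : 0 < 1 + γ * kappa m L γ := by positivity
  induction n with
  | zero => simp [Xi]; field_simp
  | succ n ih =>
    have h : ∀ n, Xi m L γ (n + 1) =
        Xi m L γ n + γ * ((1 + γ * kappa m L γ) ^ (n + 1))⁻¹ := fun n => by
      rw [Xi, Finset.sum_Icc_succ_top (by omega), mul_add, Xi]
    rw [h (n + 1), mul_add, ih, h n]
    field_simp
    ring

/-- The probability that the coupled chains have not met by time `n`. The constants
`(1 + γ κ)⁻¹` in `Ξ_n` account for the expansion of the distance by the drift, the increment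
`γ` of the variance for the Gaussian steps. -/
theorem chainCoupling_pow_apart_le {m L : ℝ} (hγ : 0 < γ)
    (hLip : ∀ x y, ‖b x - b y‖ ≤ L * ‖x - y‖)
    (hm : ∀ x y, inner ℝ (b x - b y) (x - y) ≤ -m * ‖x - y‖ ^ 2) (n : ℕ) (x y : 𝔼) :
    (chainCoupling hb γ ^ n) (x, y) apart ≤
      ENNReal.ofReal (gaussSpread (Xi m L γ n).toNNReal (‖x - y‖ / 2)) := by
  induction n generalizing x y with
  | zero =>
    by_cases h : x = y
    · rw [measure_pow_eq_zero measurableSet_apart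
        (fun z hz => chainCoupling_apart_eq_zero hb γ hz) 0 (by simpa [apart] using h)]
      exact zero_le
    · have h0 : 0 < ‖x - y‖ := norm_pos_iff.2 (sub_ne_zero.2 h)
      rw [show Xi m L γ 0 = 0 by simp [Xi], Real.toNNReal_zero,
        gaussSpread_zero_left (by positivity), ENNReal.ofReal_one]
      exact prob_le_one
  | succ n ih =>
    have hs := Real.sqrt_pos.2 hγ
    rw [add_comm, measure_pow_add _ 1 n _ measurableSet_apart, pow_one, chainCoupling_apply]
    set p : 𝔼 × 𝔼 := (x + γ • b x, y + γ • b y) with hp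
    have hmeas : Measurable fun u => (chainCoupling hb γ ^ n) u apart :=
      Kernel.measurable_coe _ measurableSet_apart
    have hdiag : ∀ u, (chainCoupling hb γ ^ n) (u, u) apart = 0 := fun u =>
      measure_pow_eq_zero measurableSet_apart
        (fun z hz => chainCoupling_apart_eq_zero hb γ hz) n (by simp [apart])
    by_cases h : p.1 = p.2
    · have : p = (p.1, p.1) := Prod.ext rfl h.symm
      rw [this, lintegral_coupledMove_diag _ _ hmeas hdiag]
      exact zero_le
    · refine (lintegral_coupledMove_le hs h (gaussSpread_neg _)
        (fun t ht => gaussSpread_nonneg _ ht) (integrable_gaussSpread _ _ _) hmeas hdiag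
        ih).trans (ENNReal.ofReal_le_ofReal ?_)
      have hκ := kappa_nonneg m L hγ
      have hc : 0 < 1 + γ * kappa m L γ := by positivity
      set c := √(1 + γ * kappa m L γ) with hcdef
      have hc0 : 0 < c := Real.sqrt_pos.2 hc
      have hc2 : c ^ 2 = 1 + γ * kappa m L γ := Real.sq_sqrt hc.le
      have hvar : (Xi m L γ n).toNNReal + (√γ ^ 2).toNNReal =
          (c ^ 2).toNNReal * (Xi m L γ (n + 1)).toNNReal := by
        rw [Real.sq_sqrt hγ.le, ← Real.toNNReal_add (Xi_nonneg m L hγ n) hγ.le, ← mul_Xi_succ m L hγ,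
          hc2, Real.toNNReal_mul hc.le]
      rw [integral_gaussSpread, hvar, add_comm 1 n, ← gaussSpread_mul hc0 _ (‖x - y‖ / 2)]
      refine monotone_gaussSpread _ ?_
      have hmin : inner ℝ (b x - b y) (x - y) ≤ -(min m 0) * ‖x - y‖ ^ 2 := by
        rcases min_cases m 0 with ⟨h, -⟩ | ⟨h, h'⟩ <;> rw [h]
        · exact hm x y
        · refine (hm x y).trans ?_
          gcongr
      have hstep := norm_step_sub_sq_le hγ (hLip x y) hmin
      have : ‖p.1 - p.2‖ ≤ c * ‖x - y‖ := by
        refine le_of_sq_le_sq (hstep.trans (le_of_eq ?_)) (by positivity)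
        rw [mul_pow, hc2, kappa]
        ring
      linarith

/-! ### The constants -/

theorem Phi_pos (t : ℝ) : 0 < Phi t := by
  rw [Phi, cdf_eq_real, measureReal_def, ENNReal.toReal_pos_iff]
  refine ⟨pos_iff_ne_zero.2 fun h => ?_, measure_lt_top _ _⟩
  have := gaussianReal_absolutelyContinuous' 0 (one_ne_zero (α := NNReal)) h
  simp at this

theorem Phi_strictMono : StrictMono Phi := by
  intro s t hst
  have hpos : 0 < (gaussianReal 0 1).real (Set.Ioc s t) := by
    rw [measureReal_def, ENNReal.toReal_pos_iff]
    refine ⟨pos_iff_ne_zero.2 fun h => ?_, measure_lt_top _ _⟩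
    have := gaussianReal_absolutelyContinuous' 0 (one_ne_zero (α := NNReal)) h
    simp at this
    linarith
  rw [Phi, Phi, cdf_eq_real, cdf_eq_real, ← Set.Iic_union_Ioc_eq_Iic hst.le,
    measureReal_union (Set.Iic_disjoint_Ioc le_rfl) measurableSet_Ioc]
  linarith

theorem Phi_zero : Phi 0 = 1 / 2 := by
  have := Phi_neg 0
  rw [neg_zero] at this
  linarith

section Constants

variable {m mp L R γbar : ℝ} {ℓ : ℕ}

/-- `ℓ ⌈1/γ⌉` steps of size `γ` take a time of at most `(1 + γbar) ℓ`. -/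
theorem mul_steps_le {γ : ℝ} (hγ : 0 < γ) (hγb : γ ≤ γbar) (ℓ : ℕ) :
    γ * ((ℓ * ⌈1 / γ⌉₊ : ℕ) : ℝ) ≤ (1 + γbar) * ℓ := by
  have h := (Nat.ceil_lt_add_one (a := 1 / γ) (by positivity)).le
  have h2 : γ * (⌈1 / γ⌉₊ : ℝ) ≤ 1 + γbar := by
    calc γ * (⌈1 / γ⌉₊ : ℝ) ≤ γ * (1 / γ + 1) := by gcongr
      _ = 1 + γ := by field_simp
      _ ≤ _ := by linarith
  push_cast
  calc γ * (ℓ * (⌈1 / γ⌉₊ : ℝ)) = γ * (⌈1 / γ⌉₊ : ℝ) * ℓ := by ring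
    _ ≤ _ := by gcongr

theorem le_mul_steps {γ : ℝ} (hγ : 0 < γ) (ℓ : ℕ) :
    (ℓ : ℝ) ≤ γ * ((ℓ * ⌈1 / γ⌉₊ : ℕ) : ℝ) := by
  have h := Nat.le_ceil (1 / γ)
  push_cast
  calc (ℓ : ℝ) = γ * (ℓ * (1 / γ)) := by field_simp
    _ ≤ _ := by gcongr

theorem Xi_ge {γ : ℝ} (hγ : 0 < γ) (hγb : γ ≤ γbar) (ℓ : ℕ) :
    ℓ * (Real.exp (kappa m L γbar * ((1 + γbar) * ℓ)))⁻¹ ≤ Xi m L γ (ℓ * ⌈1 / γ⌉₊) := by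
  set n := ℓ * ⌈1 / γ⌉₊ with hn
  have hκ := kappa_nonneg m L hγ
  have hκb : kappa m L γ ≤ kappa m L γbar := by unfold kappa; gcongr
  have hn1 := mul_steps_le hγ hγb ℓ
  have hn2 := le_mul_steps hγ ℓ
  rw [← hn] at hn1 hn2
  have hterm : ∀ k ∈ Finset.Icc 1 n, (Real.exp (kappa m L γbar * ((1 + γbar) * ℓ)))⁻¹ ≤
      ((1 + γ * kappa m L γ) ^ k)⁻¹ := by
    intro k hk
    have hkn : (k : ℝ) ≤ n := by exact_mod_cast (Finset.mem_Icc.1 hk).2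
    gcongr
    calc (1 + γ * kappa m L γ) ^ k ≤ Real.exp (γ * kappa m L γ) ^ k := by
          gcongr
          linarith [Real.add_one_le_exp (γ * kappa m L γ)]
      _ = Real.exp (kappa m L γ * (γ * k)) := by rw [← Real.exp_nat_mul]; ring_nf
      _ ≤ _ := Real.exp_le_exp.2 (mul_le_mul hκb (le_trans (by gcongr) hn1) (by positivity)
          (hκ.trans hκb))
  have hsum := Finset.card_nsmul_le_sum _ _ _ hterm
  rw [Nat.card_Icc, Nat.add_sub_cancel, nsmul_eq_mul] at hsum
  calc _ ≤ γ * n * (Real.exp (kappa m L γbar * ((1 + γbar) * ℓ)))⁻¹ := by gcongr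
    _ = γ * (n * (Real.exp (kappa m L γbar * ((1 + γbar) * ℓ)))⁻¹) := by ring
    _ ≤ _ := by unfold Xi; gcongr

theorem Xi_pos {γ : ℝ} (hγ : 0 < γ) (hℓ : 1 ≤ ℓ) : 0 < Xi m L γ (ℓ * ⌈1 / γ⌉₊) := by
  have h : (0 : ℝ) < ℓ := by exact_mod_cast hℓ
  exact lt_of_lt_of_le (by positivity) (Xi_ge (m := m) (L := L) hγ le_rfl ℓ)

theorem eps_le {γ : ℝ} (hγ : γ ∈ Set.Ioc 0 γbar) :
    eps m L R γbar ℓ ≤ 2 * Phi (-(R / (2 * √(Xi m L γ (ℓ * ⌈1 / γ⌉₊))))) :=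
  ciInf_le (f := fun γ : Set.Ioc (0 : ℝ) γbar =>
      2 * Phi (-(R / (2 * √(Xi m L γ (ℓ * ⌈1 / (γ : ℝ)⌉₊))))))
    ⟨0, by rintro _ ⟨γ, rfl⟩; exact mul_nonneg zero_le_two (Phi_pos _).le⟩ ⟨γ, hγ⟩

theorem eps_pos (hR : 0 < R) (hγbar : 0 < γbar) (hℓ : 1 ≤ ℓ) : 0 < eps m L R γbar ℓ := by
  have hℓ' : (0 : ℝ) < ℓ := by exact_mod_cast hℓ
  have : Nonempty (Set.Ioc (0 : ℝ) γbar) := ⟨⟨γbar, hγbar, le_rfl⟩⟩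
  set Y := ℓ * (Real.exp (kappa m L γbar * ((1 + γbar) * ℓ)))⁻¹ with hY
  have hY0 : 0 < Y := by positivity
  -- `Ξ` is bounded below uniformly in `γ`, so the infimum is positive.
  refine lt_of_lt_of_le (mul_pos two_pos (Phi_pos (-(R / (2 * √Y))))) (le_ciInf fun γ => ?_)
  have := Xi_ge (m := m) (L := L) γ.2.1 γ.2.2 ℓ
  have hs : 0 < √Y := Real.sqrt_pos.2 hY0
  gcongr
  refine Phi_strictMono.monotone ?_
  gcongr

theorem eps_lt_one (hR : 0 < R) (hγbar : 0 < γbar) (hℓ : 1 ≤ ℓ) : eps m L R γbar ℓ < 1 := by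
  refine (eps_le ⟨hγbar, le_rfl⟩).trans_lt ?_
  have hX := Real.sqrt_pos.2 (Xi_pos (m := m) (L := L) hγbar hℓ)
  have : Phi (-(R / (2 * √(Xi m L γbar (ℓ * ⌈1 / γbar⌉₊))))) < Phi 0 := by
    refine Phi_strictMono ?_
    rw [neg_lt_zero]
    positivity
  rw [Phi_zero] at this
  linarith

theorem driftA_pos (hmp : 0 < mp) : 0 < driftA m mp := by
  have := min_le_right m 0
  unfold driftA
  linarith

theorem rateLambda_pos : 0 < rateLambda mp L γbar := Real.exp_pos _

theorem log_rateLambda_neg (h : γbar * L ^ 2 < 2 * mp) : Real.log (rateLambda mp L γbar) < 0 := by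
  rw [rateLambda, Real.log_exp]
  linarith

theorem rateLambda_lt_one (h : γbar * L ^ 2 < 2 * mp) : rateLambda mp L γbar < 1 :=
  (Real.log_neg_iff rateLambda_pos).1 (log_rateLambda_neg h)

theorem driftSum_nonneg (hmp : 0 < mp) (hγbar : 0 < γbar) : 0 ≤ driftSum m mp L γbar ℓ := by
  have h1 := driftA_pos (m := m) hmp
  have h2 := rateLambda_pos (mp := mp) (L := L) (γbar := γbar)
  unfold driftSum
  positivity

theorem rateRho_pos : 0 < rateRho m mp L R γbar ℓ := Real.exp_pos _

theorem log_cBar_pos (hmp : 0 < mp) (hγbar : 0 < γbar) : 0 < Real.log (cBar m mp L γbar ℓ) := by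
  have := driftSum_nonneg (m := m) (L := L) (ℓ := ℓ) hmp hγbar
  exact Real.log_pos (by unfold cBar; linarith)

theorem log_one_sub_eps_neg (hR : 0 < R) (hγbar : 0 < γbar) (hℓ : 1 ≤ ℓ) :
    Real.log (1 - eps m L R γbar ℓ) < 0 :=
  Real.log_neg (by linarith [eps_lt_one (m := m) (L := L) hR hγbar hℓ])
    (by linarith [eps_pos (m := m) (L := L) hR hγbar hℓ])

theorem rateRho_lt_one (hmp : 0 < mp) (hR : 0 < R) (hγbar : 0 < γbar) (hℓ : 1 ≤ ℓ)
    (h : γbar * L ^ 2 < 2 * mp) : rateRho m mp L R γbar ℓ < 1 := by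
  have h1 := log_rateLambda_neg h
  have h2 := log_one_sub_eps_neg (m := m) (L := L) hR hγbar hℓ
  have h3 := log_cBar_pos (m := m) (L := L) (ℓ := ℓ) hmp hγbar
  rw [rateRho, Real.exp_lt_one_iff]
  exact div_neg_of_pos_of_neg (mul_pos_of_neg_of_neg h1 h2) (by linarith)

theorem rateLambda_le_rateRho (hmp : 0 < mp) (hR : 0 < R) (hγbar : 0 < γbar) (hℓ : 1 ≤ ℓ)
    (h : γbar * L ^ 2 < 2 * mp) : rateLambda mp L γbar ≤ rateRho m mp L R γbar ℓ := by
  have h1 := log_rateLambda_neg h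
  have h2 := log_one_sub_eps_neg (m := m) (L := L) hR hγbar hℓ
  have h3 := log_cBar_pos (m := m) (L := L) (ℓ := ℓ) hmp hγbar
  rw [rateRho, ← Real.log_le_iff_le_exp rateLambda_pos, le_div_iff_of_neg (by linarith)]
  nlinarith

/-- Discrete convolution of the rates `r^γ` and `r^(γ/4)`, a quotient of differences of powers. -/
theorem mul_sum_rpow_le {r γ : ℝ} (hr0 : 0 < r) (hr1 : r < 1) (hγ : 0 < γ) (hγb : γ ≤ γbar)
    (k : ℕ) :
    γ * ∑ j ∈ Finset.range k, (r ^ γ) ^ (k - 1 - j) * (r ^ (γ / 4)) ^ j ≤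
      4 / 3 / (Real.log (1 / r) * r ^ γbar) * (r ^ (γ / 4)) ^ k := by
  have hlog : 0 < Real.log (1 / r) := Real.log_pos (one_lt_one_div hr0 hr1)
  have hx : 0 < r ^ γ := Real.rpow_pos_of_pos hr0 _
  have hxb : r ^ γbar ≤ r ^ γ := Real.rpow_le_rpow_of_exponent_ge hr0 hr1.le hγb
  have hxb0 : 0 < r ^ γbar := Real.rpow_pos_of_pos hr0 _
  have hdiff : r ^ γ * (3 / 4 * (γ * Real.log (1 / r))) ≤ r ^ (γ / 4) - r ^ γ := by
    have h1 : r ^ (γ / 4) = r ^ γ * Real.exp (3 / 4 * (γ * Real.log (1 / r))) := by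
      rw [Real.rpow_def_of_pos hr0, Real.rpow_def_of_pos hr0, ← Real.exp_add, one_div,
        Real.log_inv]
      ring_nf
    rw [h1]
    nlinarith [Real.add_one_le_exp (3 / 4 * (γ * Real.log (1 / r)))]
  have hlow : r ^ γbar * (3 / 4 * (γ * Real.log (1 / r))) ≤ r ^ (γ / 4) - r ^ γ :=
    le_trans (by gcongr) hdiff
  have hgeom : (∑ j ∈ Finset.range k, (r ^ γ) ^ (k - 1 - j) * (r ^ (γ / 4)) ^ j) *
      (r ^ (γ / 4) - r ^ γ) = (r ^ (γ / 4)) ^ k - (r ^ γ) ^ k := by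
    rw [← (Commute.all (r ^ (γ / 4)) (r ^ γ)).geom_sum₂_mul]
    simp_rw [mul_comm ((r ^ γ) ^ _)]
  set T := ∑ j ∈ Finset.range k, (r ^ γ) ^ (k - 1 - j) * (r ^ (γ / 4)) ^ j
  have hT : 0 ≤ T := Finset.sum_nonneg fun j _ => by positivity
  have hmain : T * (r ^ γbar * (3 / 4 * (γ * Real.log (1 / r)))) ≤ (r ^ (γ / 4)) ^ k := by
    have h1 := mul_le_mul_of_nonneg_left hlow hT
    have h2 : 0 < (r ^ γ) ^ k := by positivity
    linarith
  rw [div_mul_eq_mul_div, le_div_iff₀ (by positivity)]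
  linarith

end Constants

variable {m mp L R γbar : ℝ} {ℓ : ℕ}

/-! ### Drift and minorization for the coupled chain -/

@[fun_prop]
theorem measurable_offDiag : Measurable (fun p : 𝔼 × 𝔼 => offDiag p.1 p.2) := by
  unfold offDiag
  exact Measurable.ite measurableSet_apart measurable_const measurable_const

theorem measurable_cost (R : ℝ) : Measurable (fun p : 𝔼 × 𝔼 => cost R p.1 p.2) := by
  unfold cost
  fun_prop

theorem cost_self (R : ℝ) (x : 𝔼) : cost R x x = 0 := by simp [cost, offDiag]

theorem cost_of_ne (R : ℝ) {x y : 𝔼} (h : x ≠ y) : cost R x y = 1 + ‖x - y‖ / R := by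
  simp [cost, offDiag, h]

theorem one_le_cost (hR : 0 < R) {x y : 𝔼} (h : x ≠ y) : 1 ≤ cost R x y := by
  rw [cost_of_ne R h]
  have : 0 ≤ ‖x - y‖ / R := by positivity
  linarith

theorem rateLambda_rpow (mp L γbar γ : ℝ) :
    rateLambda mp L γbar ^ γ = Real.exp (-(γ * (mp - γbar * L ^ 2 / 2) / 2)) := by
  rw [rateLambda, ← Real.exp_mul]
  ring_nf

/-- At distance at least `R` the cost contracts. -/
theorem cost_step_le_of_le (hR : 0 < R) (hγ : 0 < γ) (hγb : γ ≤ γbar)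
    (hγbarL : γbar * L ^ 2 < 2 * mp) {x y : 𝔼} (hxy : R ≤ ‖x - y‖)
    (hLip : ‖b x - b y‖ ≤ L * ‖x - y‖)
    (hdiss : inner ℝ (b x - b y) (x - y) ≤ -mp * ‖x - y‖ ^ 2) :
    1 + ‖(x + γ • b x) - (y + γ • b y)‖ / R ≤
      rateLambda mp L γbar ^ γ * (1 + ‖x - y‖ / R) := by
  have hstep := norm_step_sub_sq_le hγ hLip hdiss
  set t := ‖(x + γ • b x) - (y + γ • b y)‖
  set q := ‖x - y‖
  set u := γ * (mp - γbar * L ^ 2 / 2) with hu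
  have hq : 0 < q := hR.trans_le hxy
  have hu0 : 0 < u := mul_pos hγ (by linarith)
  have h1 : t ^ 2 ≤ (1 - 2 * u) * q ^ 2 := by
    refine hstep.trans ?_
    gcongr
    have : γ ^ 2 * L ^ 2 ≤ γ * (γbar * L ^ 2) := by
      rw [sq, mul_assoc]
      gcongr
    rw [hu]
    nlinarith
  have h2 : 0 ≤ 1 - 2 * u := by
    by_contra! h
    nlinarith [sq_nonneg t, sq_pos_of_pos hq]
  have h3 : t ≤ (1 - u) * q := by
    refine le_of_sq_le_sq (h1.trans ?_) (mul_nonneg (by linarith) hq.le)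
    nlinarith [mul_nonneg (sq_nonneg u) (sq_nonneg q)]
  -- The `1` in the cost does not contract; as it is at most the other summand `‖x - y‖ / R`, half of
  -- the exponent `u` is lost.
  have h4 : 1 - u / 2 ≤ rateLambda mp L γbar ^ γ := by
    rw [rateLambda_rpow, ← hu]
    linarith [Real.add_one_le_exp (-(u / 2))]
  have hqR : 1 ≤ q / R := (one_le_div hR).2 hxy
  calc 1 + t / R ≤ 1 + (1 - u) * q / R := by gcongr
    _ = 1 + (1 - u) * (q / R) := by ring
    _ ≤ (1 - u / 2) * (1 + q / R) := by nlinarith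
    _ ≤ _ := by gcongr

/-- At distance less than `R` the cost contracts up to the additive constant `γ A`. -/
theorem cost_step_le_of_lt (hR : 0 < R) (hγ : 0 < γ) (hγb : γ ≤ γbar)
    (hγbarL : γbar * L ^ 2 < 2 * mp) {x y : 𝔼} (hxy : ‖x - y‖ < R)
    (hLip : ‖b x - b y‖ ≤ L * ‖x - y‖)
    (hm : inner ℝ (b x - b y) (x - y) ≤ -m * ‖x - y‖ ^ 2) :
    1 + ‖(x + γ • b x) - (y + γ • b y)‖ / R ≤
      rateLambda mp L γbar ^ γ * (1 + ‖x - y‖ / R) + γ * driftA m mp := by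
  have hmin : inner ℝ (b x - b y) (x - y) ≤ -(min m 0) * ‖x - y‖ ^ 2 := by
    refine hm.trans ?_
    gcongr
    exact min_le_left _ _
  have hstep := norm_step_sub_sq_le hγ hLip hmin
  have hm0 := min_le_right m 0
  set m₀ := min m 0 with hm₀
  set t := ‖(x + γ • b x) - (y + γ • b y)‖
  set q := ‖x - y‖ with hq
  have hq0 : 0 ≤ q := norm_nonneg _
  set v := γ * (-m₀ + γ * L ^ 2 / 2) with hv
  have hv0 : 0 ≤ v := mul_nonneg hγ.le (by nlinarith [sq_nonneg L])
  have h3 : t ≤ (1 + v) * q := by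
    refine le_of_sq_le_sq (hstep.trans ?_) (by positivity)
    have : 1 - 2 * γ * m₀ + γ ^ 2 * L ^ 2 ≤ (1 + v) ^ 2 := by
      rw [hv] at hv0 ⊢
      nlinarith [sq_nonneg (γ * (-m₀ + γ * L ^ 2 / 2))]
    rw [mul_pow]
    gcongr
  have h4 : 1 - γ * (mp - γbar * L ^ 2 / 2) / 2 ≤ rateLambda mp L γbar ^ γ := by
    rw [rateLambda_rpow]
    linarith [Real.add_one_le_exp (-(γ * (mp - γbar * L ^ 2 / 2) / 2))]
  have hqR : q / R ≤ 1 := (div_le_one hR).2 hxy.le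
  have hqR0 : 0 ≤ q / R := by positivity
  set u := γ * (mp - γbar * L ^ 2 / 2) with hu
  have hu0 : 0 < u := mul_pos hγ (by linarith)
  have huv : u + v ≤ γ * driftA m mp := by
    rw [hu, hv, driftA, ← hm₀, ← mul_add]
    gcongr
    have : γ * L ^ 2 ≤ γbar * L ^ 2 := by gcongr
    linarith
  calc 1 + t / R ≤ 1 + (1 + v) * q / R := by gcongr
    _ = 1 + (1 + v) * (q / R) := by ring
    _ ≤ (1 - u / 2) * (1 + q / R) + (u + v) := by nlinarith
    _ ≤ _ := by gcongr

theorem lintegral_cost_chainCoupling_self (γ R : ℝ) (x : 𝔼) :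
    ∫⁻ u, ENNReal.ofReal (cost R u.1 u.2) ∂chainCoupling hb γ (x, x) = 0 := by
  rw [chainCoupling_apply]
  exact lintegral_coupledMove_diag _ _ (measurable_cost R).ennreal_ofReal
    fun u => by simp [cost_self]

/-- The pairs of distinct points at distance less than `R`. -/
def near (R : ℝ) : Set (𝔼 × 𝔼) := {p | p.1 ≠ p.2 ∧ ‖p.1 - p.2‖ < R}

theorem lintegral_cost_le_of_notMem_near (hR : 0 < R) (hγ : 0 < γ) (hγb : γ ≤ γbar)
    (hγbarL : γbar * L ^ 2 < 2 * mp)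
    (hLip : ∀ x y, ‖b x - b y‖ ≤ L * ‖x - y‖)
    (hdiss : ∀ x y, R ≤ ‖x - y‖ → inner ℝ (b x - b y) (x - y) ≤ -mp * ‖x - y‖ ^ 2)
    {z : 𝔼 × 𝔼} (hz : z ∉ near R) :
    ∫⁻ u, ENNReal.ofReal (cost R u.1 u.2) ∂chainCoupling hb γ z ≤
      ENNReal.ofReal (rateLambda mp L γbar ^ γ) * ENNReal.ofReal (cost R z.1 z.2) := by
  obtain ⟨x, y⟩ := z
  by_cases h : x = y
  · rw [h, lintegral_cost_chainCoupling_self]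
    exact zero_le
  · have hxy : R ≤ ‖x - y‖ := not_lt.1 fun h' => hz ⟨h, h'⟩
    refine (lintegral_cost_chainCoupling_le hb hγ hR x y).trans ?_
    rw [← ENNReal.ofReal_mul (Real.rpow_nonneg rateLambda_pos.le _), cost_of_ne R h]
    exact ENNReal.ofReal_le_ofReal
      (cost_step_le_of_le hR hγ hγb hγbarL hxy (hLip x y) (hdiss x y hxy))

theorem lintegral_cost_le (hmp : 0 < mp) (hR : 0 < R) (hγ : 0 < γ) (hγb : γ ≤ γbar)
    (hγbarL : γbar * L ^ 2 < 2 * mp)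
    (hLip : ∀ x y, ‖b x - b y‖ ≤ L * ‖x - y‖)
    (hm : ∀ x y, inner ℝ (b x - b y) (x - y) ≤ -m * ‖x - y‖ ^ 2)
    (hdiss : ∀ x y, R ≤ ‖x - y‖ → inner ℝ (b x - b y) (x - y) ≤ -mp * ‖x - y‖ ^ 2)
    (z : 𝔼 × 𝔼) :
    ∫⁻ u, ENNReal.ofReal (cost R u.1 u.2) ∂chainCoupling hb γ z ≤
      ENNReal.ofReal (rateLambda mp L γbar ^ γ) * ENNReal.ofReal (cost R z.1 z.2) +
        ENNReal.ofReal (γ * driftA m mp) * apart.indicator 1 z := by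
  by_cases hz : z ∈ near R
  · obtain ⟨x, y⟩ := z
    have hne : x ≠ y := hz.1
    have hl := Real.rpow_nonneg (rateLambda_pos (mp := mp) (L := L) (γbar := γbar)).le γ
    have hc := zero_le_one.trans (one_le_cost hR hne)
    have hA := (mul_pos hγ (driftA_pos (m := m) hmp)).le
    refine (lintegral_cost_chainCoupling_le hb hγ hR x y).trans ?_
    rw [Set.indicator_of_mem (show (x, y) ∈ apart from hne), Pi.one_apply, mul_one,
      ← ENNReal.ofReal_mul hl, ← ENNReal.ofReal_add (mul_nonneg hl hc) hA, cost_of_ne R hne]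
    exact ENNReal.ofReal_le_ofReal
      (cost_step_le_of_lt hR hγ hγb hγbarL hz.2 (hLip x y) (hm x y))
  · exact (lintegral_cost_le_of_notMem_near hb hR hγ hγb hγbarL hLip hdiss hz).trans
      le_self_add

theorem chainCoupling_pow_apart_le_of_near (hγ : 0 < γ) (hγb : γ ≤ γbar)
    (hℓ : 1 ≤ ℓ) (hLip : ∀ x y, ‖b x - b y‖ ≤ L * ‖x - y‖)
    (hm : ∀ x y, inner ℝ (b x - b y) (x - y) ≤ -m * ‖x - y‖ ^ 2)
    {z : 𝔼 × 𝔼} (hz : z ∈ near R) :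
    (chainCoupling hb γ ^ (ℓ * ⌈1 / γ⌉₊)) z apart ≤
      ENNReal.ofReal (1 - eps m L R γbar ℓ) := by
  refine (chainCoupling_pow_apart_le hb hγ hLip hm _ z.1 z.2).trans
    (ENNReal.ofReal_le_ofReal ?_)
  have hX := Xi_pos (m := m) (L := L) hγ hℓ
  have hle : ‖z.1 - z.2‖ / 2 ≤ R / 2 := by linarith [hz.2]
  refine (monotone_gaussSpread _ hle).trans ?_
  rw [gaussSpread_eq_one_sub_Phi hX, div_div]
  linarith [eps_le (m := m) (L := L) (R := R) (ℓ := ℓ) (γ := γ) ⟨hγ, hγb⟩]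

theorem sum_drift_le (hmp : 0 < mp) (hγ : 0 < γ) (hγb : γ ≤ γbar)
    (hγbarL : γbar * L ^ 2 < 2 * mp) {k : ℕ} (hk : k ≤ ℓ * ⌈1 / γ⌉₊) :
    γ * driftA m mp * ∑ j ∈ Finset.range k, (rateLambda mp L γbar ^ γ) ^ j ≤
      (rateLambda mp L γbar ^ γ) ^ k * driftSum m mp L γbar ℓ := by
  have hl0 := rateLambda_pos (mp := mp) (L := L) (γbar := γbar)
  have hl1 := rateLambda_lt_one hγbarL
  have hA := driftA_pos (m := m) hmp
  have hγbar : 0 < γbar := hγ.trans_le hγb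
  set l := rateLambda mp L γbar
  have hkγ : γ * (k : ℝ) ≤ (1 + γbar) * ℓ := by
    refine le_trans ?_ (mul_steps_le hγ hγb ℓ)
    gcongr
  have hsum : ∑ j ∈ Finset.range k, (l ^ γ) ^ j ≤ k := by
    refine (Finset.sum_le_card_nsmul _ _ 1 fun j _ => ?_).trans (by simp)
    exact pow_le_one₀ (by positivity) (Real.rpow_le_one hl0.le hl1.le hγ.le)
  have hpow : 1 ≤ (l ^ γ) ^ k * l ^ (-((1 + γbar) * ℓ)) := by
    rw [← Real.rpow_mul_natCast hl0.le, ← Real.rpow_add hl0]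
    exact Real.one_le_rpow_of_pos_of_le_one_of_nonpos hl0 hl1.le (by linarith)
  calc γ * driftA m mp * ∑ j ∈ Finset.range k, (l ^ γ) ^ j ≤ γ * driftA m mp * k := by gcongr
    _ = driftA m mp * (γ * k) * 1 := by ring
    _ ≤ driftA m mp * ((1 + γbar) * ℓ) * ((l ^ γ) ^ k * l ^ (-((1 + γbar) * ℓ))) := by gcongr
    _ = _ := by unfold driftSum; ring

/-! ### Survival of the distance and conclusion -/

/-- The number of excursions after which the two terms of `measure_pow_le_excursions` are balanced:
both are of order `ρ ^ t`. -/
theorem exists_balanced_excursions (hmp : 0 < mp) (hR : 0 < R) (hγbar : 0 < γbar) (hℓ : 1 ≤ ℓ)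
    (hγbarL : γbar * L ^ 2 < 2 * mp) {t : ℝ} (ht : 0 ≤ t) :
    ∃ j : ℕ, (1 - eps m L R γbar ℓ) ^ j + rateLambda mp L γbar ^ (2 * t) *
        cBar m mp L γbar ℓ ^ j ≤
      rateLambda mp L γbar ^ t * driftSum m mp L γbar ℓ +
        3 * rateRho m mp L R γbar ℓ ^ t := by
  have hl0 := rateLambda_pos (mp := mp) (L := L) (γbar := γbar)
  have hl1 := rateLambda_lt_one hγbarL
  have hlr := rateLambda_le_rateRho (m := m) hmp hR hγbar hℓ hγbarL
  have hr1 := rateRho_lt_one (m := m) hmp hR hγbar hℓ hγbarL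
  have hlogl := log_rateLambda_neg hγbarL
  have hloge := log_one_sub_eps_neg (m := m) (L := L) hR hγbar hℓ
  have hlogc := log_cBar_pos (m := m) (L := L) (ℓ := ℓ) hmp hγbar
  have hS := driftSum_nonneg (m := m) (L := L) (ℓ := ℓ) hmp hγbar
  have hq0 : 0 < 1 - eps m L R γbar ℓ := by linarith [eps_lt_one (m := m) (L := L) hR hγbar hℓ]
  have hq1 : 1 - eps m L R γbar ℓ ≤ 1 := by linarith [eps_pos (m := m) (L := L) hR hγbar hℓ]
  have hc1 : 1 ≤ cBar m mp L γbar ℓ := by unfold cBar; linarith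
  have hc0 : 0 < cBar m mp L γbar ℓ := by linarith
  set den := -Real.log (cBar m mp L γbar ℓ) + Real.log (1 - eps m L R γbar ℓ) with hden
  have hden0 : den < 0 := by linarith
  set w := t * Real.log (rateLambda mp L γbar) / den with hw
  have hw0 : 0 ≤ w := div_nonneg_of_nonpos (mul_nonpos_of_nonneg_of_nonpos ht hlogl.le) hden0.le
  have hrho : rateRho m mp L R γbar ℓ ^ t = Real.exp (Real.log (1 - eps m L R γbar ℓ) * w) := by
    rw [rateRho, ← Real.exp_mul, ← hden, hw]
    ring_nf
  have hbal : rateLambda mp L γbar ^ t * cBar m mp L γbar ℓ ^ w =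
      rateRho m mp L R γbar ℓ ^ t := by
    rw [hrho, Real.rpow_def_of_pos hl0, Real.rpow_def_of_pos hc0, ← Real.exp_add]
    congr 1
    have : t * Real.log (rateLambda mp L γbar) = den * w := by
      rw [hw, mul_div_cancel₀ _ hden0.ne]
    rw [mul_comm (Real.log (rateLambda mp L γbar)), this, hden]
    ring
  -- Rounding up `w` costs a factor `c̄ = 2 + S`, which is absorbed by `λ ^ t`, half of `λ ^ (2 t)`.
  refine ⟨⌈w⌉₊, ?_⟩
  have h1 : (1 - eps m L R γbar ℓ) ^ ⌈w⌉₊ ≤ rateRho m mp L R γbar ℓ ^ t := by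
    rw [hrho, ← Real.rpow_def_of_pos hq0, ← Real.rpow_natCast]
    exact Real.rpow_le_rpow_of_exponent_ge hq0 hq1 (Nat.le_ceil w)
  have h2 : cBar m mp L γbar ℓ ^ ⌈w⌉₊ ≤ cBar m mp L γbar ℓ * cBar m mp L γbar ℓ ^ w := by
    rw [← Real.rpow_natCast, mul_comm, ← Real.rpow_add_one hc0.ne']
    exact Real.rpow_le_rpow_of_exponent_le hc1 (Nat.ceil_lt_add_one hw0).le
  have hlt0 : 0 < rateLambda mp L γbar ^ t := Real.rpow_pos_of_pos hl0 _
  have hlt1 : rateLambda mp L γbar ^ t ≤ 1 := Real.rpow_le_one hl0.le hl1.le ht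
  have hrt0 : 0 < rateRho m mp L R γbar ℓ ^ t := Real.rpow_pos_of_pos rateRho_pos _
  have hrt1 : rateRho m mp L R γbar ℓ ^ t ≤ 1 := Real.rpow_le_one rateRho_pos.le hr1.le ht
  have h3 : rateLambda mp L γbar ^ (2 * t) * cBar m mp L γbar ℓ ^ ⌈w⌉₊ ≤
      rateLambda mp L γbar ^ t * driftSum m mp L γbar ℓ + 2 * rateRho m mp L R γbar ℓ ^ t := by
    calc rateLambda mp L γbar ^ (2 * t) * cBar m mp L γbar ℓ ^ ⌈w⌉₊
        ≤ rateLambda mp L γbar ^ (2 * t) *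
          (cBar m mp L γbar ℓ * cBar m mp L γbar ℓ ^ w) := by gcongr
      _ = rateLambda mp L γbar ^ t * rateRho m mp L R γbar ℓ ^ t *
          (2 + driftSum m mp L γbar ℓ) := by
          rw [← hbal, two_mul, Real.rpow_add hl0, cBar]
          ring
      _ = rateLambda mp L γbar ^ t * driftSum m mp L γbar ℓ * rateRho m mp L R γbar ℓ ^ t +
          2 * (rateLambda mp L γbar ^ t * rateRho m mp L R γbar ℓ ^ t) := by ring
      _ ≤ rateLambda mp L γbar ^ t * driftSum m mp L γbar ℓ * 1 +
          2 * (1 * rateRho m mp L R γbar ℓ ^ t) := by gcongr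
      _ = _ := by ring
  linarith

/-- The probability that the coupled chains have not met by time `k`, from any pair of points. -/
theorem chainCoupling_survival_le (hmp : 0 < mp) (hR : 0 < R) (hγ : 0 < γ) (hγb : γ ≤ γbar)
    (hγbarL : γbar * L ^ 2 < 2 * mp) (hℓ : 1 ≤ ℓ)
    (hLip : ∀ x y, ‖b x - b y‖ ≤ L * ‖x - y‖)
    (hm : ∀ x y, inner ℝ (b x - b y) (x - y) ≤ -m * ‖x - y‖ ^ 2)
    (hdiss : ∀ x y, R ≤ ‖x - y‖ → inner ℝ (b x - b y) (x - y) ≤ -mp * ‖x - y‖ ^ 2)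
    (k : ℕ) {x y : 𝔼} (hxy : x ≠ y) :
    (chainCoupling hb γ ^ k) (x, y) apart ≤
      ENNReal.ofReal (rateLambda mp L γbar ^ (k * γ / 4) *
          (cost R x y + driftSum m mp L γbar ℓ) +
        3 * rateRho m mp L R γbar ℓ ^ (k * γ / 4)) := by
  have hγbar : 0 < γbar := hγ.trans_le hγb
  have hl0 := rateLambda_pos (mp := mp) (L := L) (γbar := γbar)
  have hl1 := rateLambda_lt_one hγbarL
  have hS := driftSum_nonneg (m := m) (L := L) (ℓ := ℓ) hmp hγbar
  have hc0 : 0 ≤ cBar m mp L γbar ℓ := by unfold cBar; linarith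
  have hq0 : 0 < 1 - eps m L R γbar ℓ := by linarith [eps_lt_one (m := m) (L := L) hR hγbar hℓ]
  have hcost := zero_le_one.trans (one_le_cost hR hxy)
  have ht : 0 ≤ (k : ℝ) * γ / 4 := by positivity
  obtain ⟨j, hj⟩ := exists_balanced_excursions (m := m) hmp hR hγbar hℓ hγbarL ht
  set l := rateLambda mp L γbar with hl
  have hV : Measurable fun p : 𝔼 × 𝔼 => ENNReal.ofReal (cost R p.1 p.2) :=
    (measurable_cost R).ennreal_ofReal
  have habs : ∀ z ∉ apart, chainCoupling hb γ z apart = 0 :=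
    fun z hz => chainCoupling_apart_eq_zero hb γ hz
  have hV1 : ∀ z ∈ apart (d := d), 1 ≤ ENNReal.ofReal (cost R z.1 z.2) := fun z hz => by
    rw [ENNReal.one_le_ofReal]
    exact one_le_cost hR hz
  have hVC : ∀ z ∈ near (d := d) R, ENNReal.ofReal (cost R z.1 z.2) ≤ 2 := fun z hz => by
    rw [cost_of_ne R hz.1]
    refine (ENNReal.ofReal_le_ofReal ?_).trans_eq (ENNReal.ofReal_ofNat 2)
    have : ‖z.1 - z.2‖ / R ≤ 1 := (div_le_one hR).2 hz.2.le
    linarith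
  have hdrift' : ∀ z ∉ near R, _ := fun z hz =>
    lintegral_cost_le_of_notMem_near hb hR hγ hγb hγbarL hLip hdiss hz
  have hSsum : ∀ i ≤ ℓ * ⌈1 / γ⌉₊, ENNReal.ofReal (γ * driftA m mp) *
      ∑ j ∈ Finset.range i, ENNReal.ofReal (l ^ γ) ^ j ≤
        ENNReal.ofReal (l ^ γ) ^ i * ENNReal.ofReal (driftSum m mp L γbar ℓ) := by
    intro i hi
    have hlγ : 0 ≤ l ^ γ := Real.rpow_nonneg hl0.le _
    simp_rw [← ENNReal.ofReal_pow hlγ]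
    rw [← ENNReal.ofReal_sum_of_nonneg fun j _ => by positivity,
      ← ENNReal.ofReal_mul (mul_nonneg hγ.le (driftA_pos hmp).le),
      ← ENNReal.ofReal_mul (by positivity)]
    exact ENNReal.ofReal_le_ofReal (sum_drift_le hmp hγ hγb hγbarL hi)
  have hexc := (measure_pow_le_excursions hV measurableSet_apart (fun z hz => hz.1) habs hV1 hVC
    (lintegral_cost_le hb hmp hR hγ hγb hγbarL hLip hm hdiss) hdrift' hSsum
    (fun z hz => chainCoupling_pow_apart_le_of_near hb hγ hγb hℓ hLip hm hz) j).2
  -- The chain has the first half of the time to reach `near R`, and the second half for the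
  -- excursions.
  have hreach := measure_pow_le_of_reach hV measurableSet_apart habs hV1 hdrift'
    (w := fun i => ENNReal.ofReal (l ^ (γ * (i - k / 2))))
    (B := ENNReal.ofReal ((1 - eps m L R γbar ℓ) ^ j +
      l ^ (2 * (k * γ / 4)) * cBar m mp L γbar ℓ ^ j))
    (by
      rw [ENNReal.one_le_ofReal]
      refine Real.one_le_rpow_of_pos_of_le_one_of_nonpos hl0 hl1.le ?_
      have : 0 ≤ γ * ((k : ℝ) / 2) := by positivity
      push_cast
      linarith)
    (fun i => by
      rw [← ENNReal.ofReal_mul (Real.rpow_nonneg hl0.le _), ← Real.rpow_add hl0]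
      refine le_of_eq ?_
      push_cast
      ring_nf)
    (fun i => by
      rcases le_total (i : ℝ) (k / 2) with hi | hi
      · left
        rw [ENNReal.one_le_ofReal]
        exact Real.one_le_rpow_of_pos_of_le_one_of_nonpos hl0 hl1.le
          (mul_nonpos_of_nonneg_of_nonpos hγ.le (by linarith))
      · right
        intro z hz
        refine (hexc z hz i).trans ?_
        have h2 : (2 : ENNReal) + ENNReal.ofReal (driftSum m mp L γbar ℓ) =
            ENNReal.ofReal (cBar m mp L γbar ℓ) := by
          rw [cBar, ENNReal.ofReal_add zero_le_two hS, ENNReal.ofReal_ofNat]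
        have hpow : (l ^ γ) ^ i ≤ l ^ (2 * (k * γ / 4)) := by
          rw [← Real.rpow_mul_natCast hl0.le]
          refine Real.rpow_le_rpow_of_exponent_ge hl0 hl1.le ?_
          nlinarith
        have hlγ : 0 ≤ l ^ γ := Real.rpow_nonneg hl0.le _
        rw [h2, ← ENNReal.ofReal_pow hq0.le, ← ENNReal.ofReal_pow hlγ,
          ← ENNReal.ofReal_pow hc0, ← ENNReal.ofReal_mul (by positivity),
          ← ENNReal.ofReal_add (by positivity) (by positivity)]
        refine ENNReal.ofReal_le_ofReal ?_
        gcongr) k (x, y)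
  refine hreach.trans ?_
  have hw : l ^ (γ * ((k : ℝ) - k / 2)) ≤ l ^ (k * γ / 4) := by
    refine Real.rpow_le_rpow_of_exponent_ge hl0 hl1.le ?_
    have : 0 ≤ (k : ℝ) * γ := by positivity
    linarith
  have hB : 0 ≤ (1 - eps m L R γbar ℓ) ^ j + l ^ (2 * (k * γ / 4)) * cBar m mp L γbar ℓ ^ j := by
    positivity
  have hw0 : 0 ≤ l ^ (γ * ((k : ℝ) - k / 2)) := Real.rpow_nonneg hl0.le _
  rw [← ENNReal.ofReal_mul hw0, ← ENNReal.ofReal_add (mul_nonneg hw0 hcost) hB]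
  refine ENNReal.ofReal_le_ofReal ?_
  have := mul_le_mul_of_nonneg_right hw hcost
  linarith

/-- The convolution of the drift with the survival probabilities. -/
theorem lintegral_cost_pow_le (hmp : 0 < mp) (hR : 0 < R) (hγ : 0 < γ) (hγb : γ ≤ γbar)
    (hγbarL : γbar * L ^ 2 < 2 * mp) (hℓ : 1 ≤ ℓ)
    (hLip : ∀ x y, ‖b x - b y‖ ≤ L * ‖x - y‖)
    (hm : ∀ x y, inner ℝ (b x - b y) (x - y) ≤ -m * ‖x - y‖ ^ 2)
    (hdiss : ∀ x y, R ≤ ‖x - y‖ → inner ℝ (b x - b y) (x - y) ≤ -mp * ‖x - y‖ ^ 2)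
    (k : ℕ) {x y : 𝔼} (hxy : x ≠ y) :
    ∫⁻ u, ENNReal.ofReal (cost R u.1 u.2) ∂((chainCoupling hb γ ^ k) (x, y)) ≤
      ENNReal.ofReal (rateLambda mp L γbar ^ (k * γ / 4) *
          (constD1 m mp L γbar * cost R x y + constD2 m mp L γbar ℓ) +
        constE m mp L R γbar ℓ * rateRho m mp L R γbar ℓ ^ (k * γ / 4)) := by
  have hγbar : 0 < γbar := hγ.trans_le hγb
  have hl0 := rateLambda_pos (mp := mp) (L := L) (γbar := γbar)
  have hl1 := rateLambda_lt_one hγbarL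
  have hlr := rateLambda_le_rateRho (m := m) hmp hR hγbar hℓ hγbarL
  have hr0 := rateRho_pos (m := m) (mp := mp) (L := L) (R := R) (γbar := γbar) (ℓ := ℓ)
  have hr1 := rateRho_lt_one (m := m) hmp hR hγbar hℓ hγbarL
  have hS := driftSum_nonneg (m := m) (L := L) (ℓ := ℓ) hmp hγbar
  have hA := driftA_pos (m := m) hmp
  have hcost := zero_le_one.trans (one_le_cost hR hxy)
  have hconvl := mul_sum_rpow_le hl0 hl1 hγ hγb k
  have hconvr := mul_sum_rpow_le hr0 hr1 hγ hγb k
  have hlogl : 0 < Real.log (1 / rateLambda mp L γbar) := Real.log_pos (one_lt_one_div hl0 hl1)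
  have hlogr : 0 < Real.log (1 / rateRho m mp L R γbar ℓ) :=
    Real.log_pos (one_lt_one_div hr0 hr1)
  refine (lintegral_pow_le_drift (measurable_cost R).ennreal_ofReal measurableSet_apart
    (lintegral_cost_le hb hmp hR hγ hγb hγbarL hLip hm hdiss) k (x, y)).trans ?_
  have hsurv := fun j => chainCoupling_survival_le hb (ℓ := ℓ) hmp hR hγ hγb hγbarL hℓ hLip hm
    hdiss j hxy
  rw [constD2, constD1, constE]
  set l := rateLambda mp L γbar with hl
  set r := rateRho m mp L R γbar ℓ with hr
  set S := driftSum m mp L γbar ℓ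
  set A := driftA m mp
  set c := cost R x y with hc
  have hexp : ∀ {s : ℝ}, 0 < s → ∀ j : ℕ, s ^ ((j : ℝ) * γ / 4) = (s ^ (γ / 4)) ^ j := by
    intro s hs j
    rw [← Real.rpow_mul_natCast hs.le]
    ring_nf
  simp_rw [hexp hl0, hexp hr0] at hsurv ⊢
  set a := l ^ γ with ha
  set a' := r ^ γ with ha'
  set p := l ^ (γ / 4) with hp
  set p' := r ^ (γ / 4) with hp'
  have ha0 : 0 < a := Real.rpow_pos_of_pos hl0 _
  have haa' : a ≤ a' := Real.rpow_le_rpow hl0.le hlr hγ.le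
  have hp0 : 0 < p := Real.rpow_pos_of_pos hl0 _
  have hp'0 : 0 < p' := Real.rpow_pos_of_pos hr0 _
  have hap : a ≤ p := Real.rpow_le_rpow_of_exponent_ge hl0 hl1.le (by linarith)
  have hnn : ∀ j, 0 ≤ p ^ j * (c + S) + 3 * p' ^ j := fun j => by positivity
  calc ENNReal.ofReal a ^ k * ENNReal.ofReal c + ENNReal.ofReal (γ * A) *
        ∑ j ∈ Finset.range k, ENNReal.ofReal a ^ (k - 1 - j) *
          (chainCoupling hb γ ^ j) (x, y) apart
      ≤ ENNReal.ofReal a ^ k * ENNReal.ofReal c + ENNReal.ofReal (γ * A) *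
        ∑ j ∈ Finset.range k, ENNReal.ofReal a ^ (k - 1 - j) *
          ENNReal.ofReal (p ^ j * (c + S) + 3 * p' ^ j) := by
        gcongr with j hj
        exact hsurv j
    _ = ENNReal.ofReal (a ^ k * c + γ * A *
        ∑ j ∈ Finset.range k, a ^ (k - 1 - j) * (p ^ j * (c + S) + 3 * p' ^ j)) := by
        have hsum : ∀ j ∈ Finset.range k, 0 ≤ a ^ (k - 1 - j) * (p ^ j * (c + S) + 3 * p' ^ j) :=
          fun j _ => mul_nonneg (by positivity) (hnn j)
        rw [ENNReal.ofReal_add (by positivity) (mul_nonneg (by positivity)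
            (Finset.sum_nonneg hsum)), ENNReal.ofReal_mul (pow_nonneg ha0.le k),
          ENNReal.ofReal_mul (by positivity : 0 ≤ γ * A), ENNReal.ofReal_sum_of_nonneg hsum,
          ENNReal.ofReal_pow ha0.le]
        congr 2
        refine Finset.sum_congr rfl fun j _ => ?_
        rw [ENNReal.ofReal_mul (by positivity), ENNReal.ofReal_pow ha0.le]
    _ ≤ _ := by
        refine ENNReal.ofReal_le_ofReal ?_
        have hsplit : γ * A *
            ∑ j ∈ Finset.range k, a ^ (k - 1 - j) * (p ^ j * (c + S) + 3 * p' ^ j) ≤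
            A * (c + S) * (γ * ∑ j ∈ Finset.range k, a ^ (k - 1 - j) * p ^ j) +
              3 * A * (γ * ∑ j ∈ Finset.range k, a' ^ (k - 1 - j) * p' ^ j) := by
          calc _ = A * (c + S) * (γ * ∑ j ∈ Finset.range k, a ^ (k - 1 - j) * p ^ j) +
              3 * A * (γ * ∑ j ∈ Finset.range k, a ^ (k - 1 - j) * p' ^ j) := by
                simp only [Finset.mul_sum]
                rw [← Finset.sum_add_distrib]
                refine Finset.sum_congr rfl fun j _ => ?_
                ring
            _ ≤ _ := by gcongr
        have hQ : 0 ≤ A / (Real.log (1 / l) * l ^ γbar) := by positivity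
        have hQ' : 0 ≤ A / (Real.log (1 / r) * r ^ γbar) := by positivity
        set Q := A / (Real.log (1 / l) * l ^ γbar) with hQdef
        set Q' := A / (Real.log (1 / r) * r ^ γbar) with hQ'def
        have e1 : A * (c + S) * (γ * ∑ j ∈ Finset.range k, a ^ (k - 1 - j) * p ^ j) ≤
            4 / 3 * Q * (c + S) * p ^ k := by
          refine (mul_le_mul_of_nonneg_left hconvl (by positivity)).trans (le_of_eq ?_)
          rw [hQdef]; ring
        have e2 : 3 * A * (γ * ∑ j ∈ Finset.range k, a' ^ (k - 1 - j) * p' ^ j) ≤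
            4 * Q' * p' ^ k := by
          refine (mul_le_mul_of_nonneg_left hconvr (by positivity)).trans (le_of_eq ?_)
          rw [hQ'def]; ring
        have e3 : a ^ k * c ≤ p ^ k * c := by gcongr
        have f1 : 4 * A / (Real.log (1 / l) * l ^ γbar) = 4 * Q := by rw [hQdef]; ring
        have f2 : 8 * A / (Real.log (1 / r) * r ^ γbar) = 8 * Q' := by rw [hQ'def]; ring
        rw [f1, f2]
        have g1 : 0 ≤ 8 / 3 * Q * (c + S) * p ^ k := by positivity
        have g2 : 0 ≤ 4 * Q' * p' ^ k := by positivity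
        have g3 : 0 ≤ S * p ^ k := by positivity
        linarith

end EulerMaruyama

theorem theorem1 (d : ℕ) (m mp L R : ℝ) (hmp : 0 < mp) (hL : 0 ≤ L) (hR : 0 < R)
    (b : EuclideanSpace ℝ (Fin d) → EuclideanSpace ℝ (Fin d))
    (hLip : ∀ x y, ‖b x - b y‖ ≤ L * ‖x - y‖)
    (hm : ∀ x y, inner ℝ (b x - b y) (x - y) ≤ -m * ‖x - y‖ ^ 2)
    (hdiss : ∀ x y, R ≤ ‖x - y‖ → inner ℝ (b x - b y) (x - y) ≤ -mp * ‖x - y‖ ^ 2)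
    (γbar : ℝ) (hγbar : 0 < γbar) (hγbarL : γbar * L ^ 2 < 2 * mp)
    (ℓ : ℕ) (hℓ : 1 ≤ ℓ) :
    0 ≤ EulerMaruyama.constD1 m mp L γbar ∧
    0 ≤ EulerMaruyama.constD2 m mp L γbar ℓ ∧
    0 ≤ EulerMaruyama.constE m mp L R γbar ℓ ∧
    0 ≤ EulerMaruyama.rateLambda mp L γbar ∧
    EulerMaruyama.rateLambda mp L γbar ≤ EulerMaruyama.rateRho m mp L R γbar ℓ ∧
    EulerMaruyama.rateRho m mp L R γbar ℓ < 1 ∧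
    ∀ γ ∈ Set.Ioc 0 γbar, ∀ (x y : EuclideanSpace ℝ (Fin d)) (k : ℕ),
      EulerMaruyama.wasserstein (EulerMaruyama.cost R)
          ((EulerMaruyama.stepKernel b γ ^ k) x) ((EulerMaruyama.stepKernel b γ ^ k) y) ≤
        ENNReal.ofReal
          (EulerMaruyama.rateLambda mp L γbar ^ ((k : ℝ) * γ / 4) *
              (EulerMaruyama.constD1 m mp L γbar * EulerMaruyama.cost R x y +
                EulerMaruyama.constD2 m mp L γbar ℓ * EulerMaruyama.offDiag x y) +
            EulerMaruyama.constE m mp L R γbar ℓ *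
              EulerMaruyama.rateRho m mp L R γbar ℓ ^ ((k : ℝ) * γ / 4) *
              EulerMaruyama.offDiag x y) := by
  have hl0 := EulerMaruyama.rateLambda_pos (mp := mp) (L := L) (γbar := γbar)
  have hl1 := EulerMaruyama.rateLambda_lt_one hγbarL
  have hlr := EulerMaruyama.rateLambda_le_rateRho (m := m) hmp hR hγbar hℓ hγbarL
  have hr1 := EulerMaruyama.rateRho_lt_one (m := m) hmp hR hγbar hℓ hγbarL
  have hr0 := EulerMaruyama.rateRho_pos (m := m) (mp := mp) (L := L) (R := R) (γbar := γbar)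
    (ℓ := ℓ)
  have hS := EulerMaruyama.driftSum_nonneg (m := m) (L := L) (ℓ := ℓ) hmp hγbar
  have hA := EulerMaruyama.driftA_pos (m := m) hmp
  have hlogl := Real.log_pos (one_lt_one_div hl0 hl1)
  have hlogr := Real.log_pos (one_lt_one_div hr0 hr1)
  have hD1 : 0 ≤ EulerMaruyama.constD1 m mp L γbar := by
    unfold EulerMaruyama.constD1
    positivity
  refine ⟨hD1, mul_nonneg hD1 hS, by unfold EulerMaruyama.constE; positivity, hl0.le, hlr, hr1,
    fun γ hγ x y k => ?_⟩
  have hb : Measurable b :=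
    (LipschitzWith.of_dist_le_mul (K := ⟨L, hL⟩)
      fun x y => by rw [dist_eq_norm, dist_eq_norm]; exact hLip x y).continuous.measurable
  refine (EulerMaruyama.wasserstein_le_lintegral_chainCoupling hb hγ.1 R x y k).trans ?_
  by_cases hxy : x = y
  · subst hxy
    refine (EulerMaruyama.lintegral_pow_le_drift
      (EulerMaruyama.measurable_cost R).ennreal_ofReal EulerMaruyama.measurableSet_apart
      (EulerMaruyama.lintegral_cost_le hb hmp hR hγ.1 hγ.2 hγbarL hLip hm hdiss) k (x, x)).trans
      (le_of_eq_of_le ?_ zero_le)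
    have hzero : ∀ j, (EulerMaruyama.chainCoupling hb γ ^ j) (x, x) EulerMaruyama.apart = 0 :=
      fun j => EulerMaruyama.measure_pow_eq_zero EulerMaruyama.measurableSet_apart
        (fun z hz => EulerMaruyama.chainCoupling_apart_eq_zero hb γ hz) j
        (by simp [EulerMaruyama.apart])
    simp [EulerMaruyama.cost_self, hzero]
  · have hoff : EulerMaruyama.offDiag x y = 1 := by simp [EulerMaruyama.offDiag, hxy]
    rw [hoff, mul_one, mul_one]
    exact EulerMaruyama.lintegral_cost_pow_le hb hmp hR hγ.1 hγ.2 hγbarL hℓ hLip hm hdiss k hxy
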